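/- Let $N\ge 2$ and let $\Omega\subset\mathbb{R}^N$ be a nonempty bounded open set. For $p>1$ let $W_0^{1,p}(\Omega)$ be the closure of $C_c^\infty(\Omega)$ in the Sobolev space $W^{1,p}(\Omega)$, and for a Lebesgue measurable set $E\subset\Omega$ put $$ \lambda_1(p;E):=\inf\left\{\frac{\int_E|\nabla u|^p\,dx}{\int_E|u|^p\,dx}:\ u\in W_0^{1,p}(\Omega)\setminus\{0\},\ u=0\text{ a.e. on }\Omega\setminus E\right\}, $$ with $\lambda_1(p;E)=+\infty$ if no such $u$ exists. For an integer $k\ge1$ let $\mathcal{E}_k$ be the family of all $k$-tuples $(E_1,\dots,E_k)$ of pairwise disjoint Lebesgue measurable subsets of $\Omega$ of positive Lebesgue measure, and let $$ \mathfrak{L}_k(p;\Omega):=\inf_{(E_1,\dots,E_k)\in\mathcal{E}_k}\ \max_{i=1,\dots,k}\lambda_1(p;E_i). $$ Then for every integer $k\ge 1$ and every real $p>1$ the value $\mathfrak{L}_k(p;\Omega)$ is attained, that is, there is a $k$-th spectral minimal partition of $\Omega$: a $k$-tuple $(E_1,\dots,E_k)\in\mathcal{E}_k$ with $\max_{i=1,\dots,k}\lambda_1(p;E_i)=\mathfrak{L}_k(p;\Omega)$.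 -/

import Mathlib

open MeasureTheory TopologicalSpace
open scoped ENNReal Distributions

noncomputable section

namespace SpectralPartition

/-- `G` is the weak (distributional) gradient of `u` on the open set `Ω`: both are locally
integrable on `Ω` and `∫_Ω u ∂ᵢφ = -∫_Ω Gᵢ φ` for all `i` and all `φ ∈ C_c^∞(Ω)`. -/
structure HasWeakGradient {N : ℕ} (Ω : Opens (EuclideanSpace ℝ (Fin N)))
    (u : EuclideanSpace ℝ (Fin N) → ℝ)
    (G : EuclideanSpace ℝ (Fin N) → EuclideanSpace ℝ (Fin N)) : Prop where
  locallyIntegrableOn : LocallyIntegrableOn u (Ω : Set (EuclideanSpace ℝ (Fin N))) volume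
  locallyIntegrableOn_grad : LocallyIntegrableOn G (Ω : Set (EuclideanSpace ℝ (Fin N))) volume
  integral_eq : ∀ (φ : 𝓓(Ω, ℝ)) (i : Fin N),
    ∫ x in (Ω : Set (EuclideanSpace ℝ (Fin N))), u x * fderiv ℝ φ x (EuclideanSpace.single i 1) =
      -∫ x in (Ω : Set (EuclideanSpace ℝ (Fin N))), G x i * φ x

/-- `u ∈ W^{1,p}(Ω)` with weak gradient `G` (which `u` determines almost everywhere on `Ω`). -/
structure MemW1p {N : ℕ} (Ω : Opens (EuclideanSpace ℝ (Fin N))) (p : ℝ)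
    (u : EuclideanSpace ℝ (Fin N) → ℝ)
    (G : EuclideanSpace ℝ (Fin N) → EuclideanSpace ℝ (Fin N)) : Prop where
  hasWeakGradient : HasWeakGradient Ω u G
  memLp : MemLp u (ENNReal.ofReal p) (volume.restrict (Ω : Set (EuclideanSpace ℝ (Fin N))))
  memLp_grad : MemLp G (ENNReal.ofReal p) (volume.restrict (Ω : Set (EuclideanSpace ℝ (Fin N))))

/-- `u ∈ W_0^{1,p}(Ω)` with weak gradient `G`: `u` lies in the closure of `C_c^∞(Ω)`
with respect to the norm `‖u‖_{L^p(Ω)} + ‖∇u‖_{L^p(Ω)}` of `W^{1,p}(Ω)`. -/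
structure MemW01p {N : ℕ} (Ω : Opens (EuclideanSpace ℝ (Fin N))) (p : ℝ)
    (u : EuclideanSpace ℝ (Fin N) → ℝ)
    (G : EuclideanSpace ℝ (Fin N) → EuclideanSpace ℝ (Fin N)) : Prop
    extends MemW1p Ω p u G where
  mem_closure : ∀ ε : ℝ≥0∞, 0 < ε → ∃ φ : 𝓓(Ω, ℝ),
    eLpNorm (fun x => u x - φ x) (ENNReal.ofReal p)
        (volume.restrict (Ω : Set (EuclideanSpace ℝ (Fin N)))) +
      eLpNorm (fun x => G x - gradient φ x) (ENNReal.ofReal p)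
        (volume.restrict (Ω : Set (EuclideanSpace ℝ (Fin N)))) < ε

/-- The competitors for `λ₁(p; E)`: nonzero `u ∈ W_0^{1,p}(Ω)` (with weak gradient `G`)
such that `u = 0` almost everywhere on `Ω \ E`. -/
structure IsAdmissible {N : ℕ} (Ω : Opens (EuclideanSpace ℝ (Fin N))) (p : ℝ)
    (E : Set (EuclideanSpace ℝ (Fin N))) (u : EuclideanSpace ℝ (Fin N) → ℝ)
    (G : EuclideanSpace ℝ (Fin N) → EuclideanSpace ℝ (Fin N)) : Prop where
  memW01p : MemW01p Ω p u G
  ne_zero : ¬ u =ᵐ[volume.restrict (Ω : Set (EuclideanSpace ℝ (Fin N)))] 0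
  eq_zero : ∀ᵐ x, x ∈ (Ω : Set (EuclideanSpace ℝ (Fin N))) \ E → u x = 0

/-- The Rayleigh quotient `∫_E |∇u|^p / ∫_E |u|^p`, where `G = ∇u`. -/
def rayleighQuotient {N : ℕ} (p : ℝ) (E : Set (EuclideanSpace ℝ (Fin N)))
    (u : EuclideanSpace ℝ (Fin N) → ℝ)
    (G : EuclideanSpace ℝ (Fin N) → EuclideanSpace ℝ (Fin N)) : ℝ≥0∞ :=
  (∫⁻ x in E, ‖G x‖ₑ ^ p) / (∫⁻ x in E, ‖u x‖ₑ ^ p)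

/-- The first eigenvalue `λ₁(p; E)` of the `p`-Laplacian on `E ⊆ Ω`;
it is `∞` if there is no admissible function. -/
def firstEigenvalue {N : ℕ} (Ω : Opens (EuclideanSpace ℝ (Fin N))) (p : ℝ)
    (E : Set (EuclideanSpace ℝ (Fin N))) : ℝ≥0∞ :=
  ⨅ (u : EuclideanSpace ℝ (Fin N) → ℝ)
    (G : EuclideanSpace ℝ (Fin N) → EuclideanSpace ℝ (Fin N))
    (_ : IsAdmissible Ω p E u G), rayleighQuotient p E u G

/-- The family of `k`-tuples of pairwise disjoint Lebesgue measurable subsets of `Ω` with positive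
Lebesgue measure. -/
def partitions {N : ℕ} (Ω : Opens (EuclideanSpace ℝ (Fin N))) (k : ℕ) :
    Set (Fin k → Set (EuclideanSpace ℝ (Fin N))) :=
  {E | (∀ i, NullMeasurableSet (E i) volume) ∧ (∀ i, E i ⊆ Ω) ∧ (∀ i, 0 < volume (E i)) ∧
    Pairwise fun i j => Disjoint (E i) (E j)}

/-- `max_{i} λ₁(p; E_i)`. -/
def partitionEnergy {N : ℕ} (Ω : Opens (EuclideanSpace ℝ (Fin N))) (p : ℝ) {k : ℕ}
    (E : Fin k → Set (EuclideanSpace ℝ (Fin N))) : ℝ≥0∞ :=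
  ⨆ i, firstEigenvalue Ω p (E i)

/-- `𝔏_k(p; Ω)`, the infimum of `max_{i} λ₁(p; E_i)` over the family of `k`-tuples above. -/
def minimalPartitionValue {N : ℕ} (Ω : Opens (EuclideanSpace ℝ (Fin N))) (p : ℝ) (k : ℕ) :
    ℝ≥0∞ :=
  ⨅ E ∈ partitions Ω k, partitionEnergy Ω p E

/-- A `k`-th spectral minimal partition of `Ω`: a `k`-tuple at which `𝔏_k(p; Ω)` is attained. -/
def IsSpectralMinimalPartition {N : ℕ} (Ω : Opens (EuclideanSpace ℝ (Fin N))) (p : ℝ) {k : ℕ}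
    (E : Fin k → Set (EuclideanSpace ℝ (Fin N))) : Prop :=
  E ∈ partitions Ω k ∧ partitionEnergy Ω p E = minimalPartitionValue Ω p k

end SpectralPartition

end

/-!
Minimal partitions are obtained by the direct method.

Nearly optimal partitions, together with nearly optimal admissible functions on their members,
give sequences `(u_i^n, ∇u_i^n)` for `i < k`, normalised in `L^p(Ω)`, with disjoint supports and
with `‖∇u_i^n‖_p^p` at most `𝔏_k(p; Ω) + 1/(n+1)`. The Rayleigh quotient only sees the gradient on `E_i`,
so that the bound on all of `Ω` rests on Stampacchia's lemma `MemW01p.ae_grad_eq_zero`: the gradient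
vanishes almost everywhere where the function does.

Since `Ω` is bounded, bounded sets of `W_0^{1,p}(Ω)` are totally bounded in `L^p(Ω)`
(`totallyBounded_sobolevZero`). For a test function `w`, the values at points of a ball of
radius `r` differ from the average over the ball by at most an oscillation, whose `L^p` norm is of order
`r ‖∇w‖_p` by the translation estimate `lintegral_translate_sub_le`; hence finitely many averages
determine `w` in `L^p(Ω)` up to a small error. Along a subsequence the `u_i^n` therefore converge
in `L^p(Ω)` to functions `v_i` of norm `1` with almost everywhere disjoint supports.

That `v_i` lies in `W_0^{1,p}(Ω)` with `‖∇v_i‖_p^p ≤ 𝔏_k(p; Ω)` would usually be read off from weak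
compactness. Here uniform convexity of `L^p` is used instead (`uniformConvexSpace_Lp`,
`exists_mem_of_tendsto_fst`): `W_0^{1,p}(Ω)` is a closed subspace of `L^p × L^p`, and among its
elements whose first component is close to `v_i`, those with almost minimal gradient norm form a Cauchy
sequence. Finally the sets where `v_i` is nonzero and the other `v_j` vanish form the
required `k`-tuple, with `v_i` as a competitor on the `i`-th set
(`exists_partition_of_disjoint_supports`).
-/

namespace SpectralPartition

open Filter Topology

/-! ### Uniform convexity of `L^p` -/

section UniformConvexity

variable {F : Type*} [NormedAddCommGroup F]

variable {α : Type*} [MeasurableSpace α] {μ : Measure α}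

theorem Lp_norm_rpow {p : ℝ} (hp : 0 < p) (f : Lp F (ENNReal.ofReal p) μ) :
    ‖f‖ ^ p = ∫ x, ‖f x‖ ^ p ∂μ := by
  have hp' := ENNReal.toReal_ofReal hp.le
  rw [Lp.norm_def, toReal_eLpNorm (Lp.aestronglyMeasurable f),
    lpNorm_eq_integral_norm_rpow_toReal (by simpa using hp) ENNReal.ofReal_ne_top
      (Lp.aestronglyMeasurable f), hp', ← Real.rpow_mul (integral_nonneg fun _ => by positivity),
    inv_mul_cancel₀ hp.ne', Real.rpow_one]

theorem Lp_integrable_norm_rpow {p : ℝ} (hp : 0 < p) (f : Lp F (ENNReal.ofReal p) μ) :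
    Integrable (fun x => ‖f x‖ ^ p) μ := by
  have := (Lp.memLp f).integrable_norm_rpow (by simpa using hp) ENNReal.ofReal_ne_top
  rwa [ENNReal.toReal_ofReal hp.le] at this

variable [NormedSpace ℝ F]

/-- The Jensen defect of the function `‖·‖ ^ p` at the midpoint of `a` and `b`. -/
noncomputable def midpointDefect (p : ℝ) (a b : F) : ℝ :=
  (‖a‖ ^ p + ‖b‖ ^ p) / 2 - ‖(2⁻¹ : ℝ) • (a + b)‖ ^ p

theorem norm_half_add_le (a b : F) :
    ‖(2⁻¹ : ℝ) • (a + b)‖ ≤ (2⁻¹ : ℝ) * ‖a‖ + (2⁻¹ : ℝ) * ‖b‖ := by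
  rw [norm_smul, ← mul_add]
  norm_num
  exact norm_add_le a b

theorem midpointDefect_nonneg {p : ℝ} (hp : 1 < p) (a b : F) : 0 ≤ midpointDefect p a b := by
  have h := (convexOn_rpow hp.le).2 (norm_nonneg a) (norm_nonneg b)
    (by norm_num : (0 : ℝ) ≤ 2⁻¹) (by norm_num : (0 : ℝ) ≤ 2⁻¹) (by norm_num)
  have h' := Real.rpow_le_rpow (norm_nonneg _) (norm_half_add_le a b) (by linarith : 0 ≤ p)
  simp only [smul_eq_mul] at h
  unfold midpointDefect
  linarith

theorem midpointDefect_pos [StrictConvexSpace ℝ F] {p : ℝ} (hp : 1 < p) {a b : F} (hab : a ≠ b) :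
    0 < midpointDefect p a b := by
  unfold midpointDefect
  by_cases hn : ‖a‖ = ‖b‖
  · have h := norm_combo_lt_of_ne le_rfl hn.ge hab (by norm_num : (0 : ℝ) < 2⁻¹)
      (by norm_num : (0 : ℝ) < 2⁻¹) (by norm_num)
    rw [← smul_add] at h
    have h' := Real.rpow_lt_rpow (norm_nonneg _) h (by linarith : 0 < p)
    rw [← hn]
    linarith
  · have h := (strictConvexOn_rpow hp).2 (norm_nonneg a) (norm_nonneg b) hn
      (by norm_num : (0 : ℝ) < 2⁻¹) (by norm_num : (0 : ℝ) < 2⁻¹) (by norm_num)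
    have h' := Real.rpow_le_rpow (norm_nonneg _) (norm_half_add_le a b) (by linarith : 0 ≤ p)
    simp only [smul_eq_mul] at h
    linarith

theorem continuous_midpointDefect {p : ℝ} (hp : 0 ≤ p) :
    Continuous fun z : F × F => midpointDefect p z.1 z.2 := by
  unfold midpointDefect
  have h : ∀ {f : F × F → F}, Continuous f → Continuous fun z => ‖f z‖ ^ p :=
    fun hf => hf.norm.rpow_const fun _ => Or.inr hp
  exact (((h continuous_fst).add (h continuous_snd)).div_const 2).sub
    (h ((continuous_fst.add continuous_snd).const_smul _))

theorem midpointDefect_smul {p : ℝ} {t : ℝ} (ht : 0 ≤ t) (a b : F) :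
    midpointDefect p (t • a) (t • b) = t ^ p * midpointDefect p a b := by
  unfold midpointDefect
  rw [← smul_add, smul_comm, norm_smul t, norm_smul t, norm_smul t, Real.norm_of_nonneg ht,
    Real.mul_rpow ht (norm_nonneg _), Real.mul_rpow ht (norm_nonneg _),
    Real.mul_rpow ht (norm_nonneg _)]
  ring

/-- The Jensen defect controls the distance, up to an arbitrarily small multiple of
`‖a‖ ^ p + ‖b‖ ^ p`. On the compact set where `‖a‖ ^ p + ‖b‖ ^ p = 1` and `ε ≤ ‖a - b‖ ^ p` the
defect is bounded below by strict convexity; the general case follows by homogeneity. -/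
theorem exists_norm_sub_rpow_le [StrictConvexSpace ℝ F] [FiniteDimensional ℝ F] {p : ℝ}
    (hp : 1 < p) {ε : ℝ} (hε : 0 < ε) :
    ∃ C : ℝ, 0 < C ∧ ∀ a b : F,
      ‖a - b‖ ^ p ≤ ε * (‖a‖ ^ p + ‖b‖ ^ p) + C * midpointDefect p a b := by
  have hp0 : 0 < p := by linarith
  have hcont : ∀ {f : F × F → F}, Continuous f → Continuous fun z => ‖f z‖ ^ p :=
    fun hf => hf.norm.rpow_const fun _ => Or.inr hp0.le
  have : ProperSpace F := FiniteDimensional.proper ℝ F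
  have key : ∃ C : ℝ, 0 < C ∧ ∀ a b : F, ‖a‖ ^ p + ‖b‖ ^ p = 1 →
      ‖a - b‖ ^ p ≤ ε + C * midpointDefect p a b := by
    let K : Set (F × F) :=
      {z | ‖z.1‖ ^ p + ‖z.2‖ ^ p = 1} ∩ {z | ε ≤ ‖z.1 - z.2‖ ^ p}
    have hle : ∀ z : F × F, ‖z.1‖ ^ p + ‖z.2‖ ^ p = 1 → ‖z.1‖ ≤ 1 ∧ ‖z.2‖ ≤ 1 := by
      intro z hz
      have h1 := Real.rpow_nonneg (norm_nonneg z.1) p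
      have h2 := Real.rpow_nonneg (norm_nonneg z.2) p
      constructor
      · by_contra! h
        have := Real.one_lt_rpow h hp0
        linarith
      · by_contra! h
        have := Real.one_lt_rpow h hp0
        linarith
    have hK : IsCompact K := by
      refine Metric.isCompact_of_isClosed_isBounded ?_ ?_
      · exact (isClosed_eq ((hcont continuous_fst).add (hcont continuous_snd))
          continuous_const).inter (isClosed_le continuous_const
            (hcont (continuous_fst.sub continuous_snd)))
      · refine (Metric.isBounded_closedBall (x := (0 : F × F)) (r := 1)).subset ?_
        intro z hz
        rw [mem_closedBall_zero_iff, Prod.norm_def]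
        exact max_le (hle z hz.1).1 (hle z hz.1).2
    have h2p : ∀ z : F × F, ‖z.1‖ ^ p + ‖z.2‖ ^ p = 1 → ‖z.1 - z.2‖ ^ p ≤ 2 ^ p := by
      intro z hz
      refine Real.rpow_le_rpow (norm_nonneg _) ?_ hp0.le
      have := norm_sub_le z.1 z.2
      have := hle z hz
      linarith
    rcases K.eq_empty_or_nonempty with hKe | hKne
    · refine ⟨1, one_pos, fun a b hab => ?_⟩
      have : (a, b) ∉ K := by simp [hKe]
      have h : ‖a - b‖ ^ p < ε := by
        by_contra! h
        exact this ⟨hab, h⟩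
      have := midpointDefect_nonneg hp a b
      linarith
    · obtain ⟨z, hzK, hz⟩ := hK.exists_isMinOn hKne (continuous_midpointDefect hp0.le).continuousOn
      have hz0 : 0 < midpointDefect p z.1 z.2 := by
        refine midpointDefect_pos hp fun h => ?_
        have := hzK.2
        simp only [Set.mem_ofPred_eq, h, sub_self, norm_zero, Real.zero_rpow hp0.ne'] at this
        linarith
      refine ⟨2 ^ p / midpointDefect p z.1 z.2, by positivity, fun a b hab => ?_⟩
      have hnn := midpointDefect_nonneg hp a b
      by_cases h : ε ≤ ‖a - b‖ ^ p
      · have hm : midpointDefect p z.1 z.2 ≤ midpointDefect p a b :=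
          hz (show (a, b) ∈ K from ⟨hab, h⟩)
        have h1 := h2p (a, b) hab
        have : (2 : ℝ) ^ p ≤ 2 ^ p / midpointDefect p z.1 z.2 * midpointDefect p a b := by
          rw [div_mul_eq_mul_div, le_div_iff₀ hz0]
          gcongr
        simp only at h1
        linarith
      · have : 0 ≤ 2 ^ p / midpointDefect p z.1 z.2 * midpointDefect p a b := by positivity
        linarith
  obtain ⟨C, hC, h⟩ := key
  refine ⟨C, hC, fun a b => ?_⟩
  set s := ‖a‖ ^ p + ‖b‖ ^ p with hs
  have ha := Real.rpow_nonneg (norm_nonneg a) p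
  have hb := Real.rpow_nonneg (norm_nonneg b) p
  rcases (add_nonneg ha hb).eq_or_lt with h0 | h0
  · have ha0 : a = 0 := by
      by_contra hne
      have := Real.rpow_pos_of_pos (norm_pos_iff.2 hne) p
      linarith
    have hb0 : b = 0 := by
      by_contra hne
      have := Real.rpow_pos_of_pos (norm_pos_iff.2 hne) p
      linarith
    subst ha0 hb0
    simp [hs, midpointDefect, Real.zero_rpow hp0.ne']
  · have hs0 : 0 < s := h0
    set t := s ^ (-p⁻¹) with ht
    have ht0 : 0 ≤ t := by positivity
    have htp : t ^ p = s⁻¹ := by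
      rw [ht, ← Real.rpow_mul hs0.le, neg_mul, inv_mul_cancel₀ hp0.ne', Real.rpow_neg_one]
    have hn : ∀ c : F, ‖t • c‖ ^ p = s⁻¹ * ‖c‖ ^ p := fun c => by
      rw [norm_smul, Real.norm_of_nonneg ht0, Real.mul_rpow ht0 (norm_nonneg _), htp]
    have := h (t • a) (t • b) (by rw [hn, hn, ← mul_add, ← hs, inv_mul_cancel₀ hs0.ne'])
    rw [← smul_sub, hn, midpointDefect_smul ht0, htp] at this
    have h2 := mul_le_mul_of_nonneg_left this hs0.le
    rw [mul_inv_cancel_left₀ hs0.ne'] at h2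
    calc ‖a - b‖ ^ p ≤ s * (ε + C * (s⁻¹ * midpointDefect p a b)) := h2
      _ = ε * s + C * midpointDefect p a b := by field_simp

/-- Clarkson's theorem, for functions with values in a finite-dimensional strictly convex space. -/
theorem uniformConvexSpace_Lp [StrictConvexSpace ℝ F] [FiniteDimensional ℝ F] {p : ℝ}
    (hp : 1 < p) [Fact (1 ≤ ENNReal.ofReal p)] :
    UniformConvexSpace (Lp F (ENNReal.ofReal p) μ) := by
  have hp0 : 0 < p := by linarith
  refine ⟨fun ε hε => ?_⟩
  have hε' : 0 < ε ^ p / 4 := by positivity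
  -- For unit vectors `f`, `g` at distance at least `ε` the integrated pointwise estimate reads
  -- `ε ^ p ≤ ε ^ p / 2 + C * (1 - ‖(f + g) / 2‖ ^ p)`.
  obtain ⟨C, hC, hpt⟩ := exists_norm_sub_rpow_le (F := F) hp hε'
  set c := min 1 (ε ^ p / (2 * C)) with hc
  have hc0 : 0 < c := by positivity
  have hc1 : c ≤ 1 := min_le_left _ _
  refine ⟨2 - 2 * (1 - c) ^ p⁻¹, ?_, ?_⟩
  · have : (1 - c) ^ p⁻¹ < 1 :=
      Real.rpow_lt_one (by linarith) (by linarith) (by positivity)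
    linarith
  · intro f hf g hg hfg
    have hm : ∫ x, ‖(f - g) x‖ ^ p ∂μ ≤ ∫ x, (ε ^ p / 4 * (‖f x‖ ^ p + ‖g x‖ ^ p) +
        C * ((‖f x‖ ^ p + ‖g x‖ ^ p) / 2 - ‖((2⁻¹ : ℝ) • (f + g)) x‖ ^ p)) ∂μ := by
      have hf' := Lp_integrable_norm_rpow hp0 f
      have hg' := Lp_integrable_norm_rpow hp0 g
      have hfg' := Lp_integrable_norm_rpow hp0 ((2⁻¹ : ℝ) • (f + g))
      refine integral_mono_ae (Lp_integrable_norm_rpow hp0 _)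
        (((hf'.add hg').const_mul _).add ((((hf'.add hg').div_const 2).sub hfg').const_mul _)) ?_
      filter_upwards [Lp.coeFn_sub f g, Lp.coeFn_add f g, Lp.coeFn_smul (2⁻¹ : ℝ) (f + g)]
        with x h1 h2 h3
      rw [h1, h3, Pi.smul_apply, h2]
      exact hpt (f x) (g x)
    have hf' := Lp_integrable_norm_rpow hp0 f
    have hg' := Lp_integrable_norm_rpow hp0 g
    have hfg' := Lp_integrable_norm_rpow hp0 ((2⁻¹ : ℝ) • (f + g))
    rw [integral_add (by exact (hf'.add hg').const_mul _)
      (by exact (((hf'.add hg').div_const 2).sub hfg').const_mul _),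
      integral_const_mul, integral_const_mul,
      integral_sub (by exact (hf'.add hg').div_const 2) hfg', integral_div, integral_add hf' hg',
      ← Lp_norm_rpow hp0, ← Lp_norm_rpow hp0, ← Lp_norm_rpow hp0, ← Lp_norm_rpow hp0, hf, hg,
      Real.one_rpow] at hm
    have h1 : ε ^ p ≤ ‖f - g‖ ^ p := Real.rpow_le_rpow hε.le hfg hp0.le
    have h2 : ‖(2⁻¹ : ℝ) • (f + g)‖ ^ p ≤ 1 - ε ^ p / (2 * C) := by
      have : C * (ε ^ p / (2 * C)) = ε ^ p / 2 := by field_simp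
      have h3 : C * ‖(2⁻¹ : ℝ) • (f + g)‖ ^ p ≤ C * (1 - ε ^ p / (2 * C)) := by linarith
      exact le_of_mul_le_mul_left h3 hC
    have h3 : ‖(2⁻¹ : ℝ) • (f + g)‖ ^ p ≤ 1 - c := h2.trans (by
      have := min_le_right 1 (ε ^ p / (2 * C))
      linarith)
    have h4 : ‖(2⁻¹ : ℝ) • (f + g)‖ ≤ (1 - c) ^ p⁻¹ := by
      rwa [Real.le_rpow_inv_iff_of_pos (norm_nonneg _) (by linarith) hp0]
    rw [norm_smul] at h4
    norm_num at h4
    linarith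

end UniformConvexity

/-! ### Weak limits by convexity -/

/-- A replacement for weak compactness in the second factor. The points `y` for which some
`(x', y) ∈ K` has `x'` close to `x` form a decreasing family of convex sets, and by uniform
convexity their elements of almost minimal norm form a Cauchy sequence. -/
theorem exists_mem_of_tendsto_fst {X Y : Type*} [NormedAddCommGroup X] [NormedSpace ℝ X]
    [NormedAddCommGroup Y] [NormedSpace ℝ Y] [CompleteSpace Y] [UniformConvexSpace Y]
    {K : Set (X × Y)} (hKc : IsClosed K) (hK : Convex ℝ K) {x : ℕ → X} {y : ℕ → Y}
    (hxy : ∀ n, (x n, y n) ∈ K) {x₀ : X} (hx : Tendsto x atTop (𝓝 x₀)) {r : ℕ → ℝ} {r₀ : ℝ}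
    (hy : ∀ n, ‖y n‖ ≤ r n) (hr : Tendsto r atTop (𝓝 r₀)) :
    ∃ y₀, (x₀, y₀) ∈ K ∧ ‖y₀‖ ≤ r₀ := by
  let C : ℕ → Set Y := fun n => {z | ∃ x', ‖x' - x₀‖ ≤ 1 / ((n : ℝ) + 1) ∧ (x', z) ∈ K}
  have hanti : ∀ {m n : ℕ}, m ≤ n → C n ⊆ C m := by
    rintro m n hmn z ⟨x', hx', hz⟩
    refine ⟨x', hx'.trans ?_, hz⟩
    gcongr
  have hev : ∀ n, ∀ᶠ m in atTop, y m ∈ C n := by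
    intro n
    have hpos : 0 < 1 / ((n : ℝ) + 1) := by positivity
    filter_upwards [Metric.tendsto_nhds.1 hx _ hpos] with m hm
    exact ⟨x m, by rw [← dist_eq_norm]; exact hm.le, hxy m⟩
  have hne : ∀ n, (C n).Nonempty := fun n => 
    let ⟨m, hm⟩ := (hev n).exists
    ⟨y m, hm⟩
  have hmid : ∀ n, ∀ z ∈ C n, ∀ w ∈ C n, (2⁻¹ : ℝ) • (z + w) ∈ C n := by
    rintro n z ⟨x', hx', hz⟩ w ⟨x'', hx'', hw⟩
    refine ⟨(2⁻¹ : ℝ) • (x' + x''), ?_, ?_⟩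
    · have h : (2⁻¹ : ℝ) • (x' + x'') - x₀ = (2⁻¹ : ℝ) • ((x' - x₀) + (x'' - x₀)) := by
        module
      rw [h]
      refine (norm_half_add_le _ _).trans ?_
      linarith
    · have := hK hz hw (by norm_num : (0 : ℝ) ≤ 2⁻¹) (by norm_num : (0 : ℝ) ≤ 2⁻¹) (by norm_num)
      simpa [smul_add] using this
  let d : ℕ → ℝ := fun n => sInf (norm '' C n)
  have hbdd : ∀ n, BddBelow (norm '' C n) := fun n =>
    ⟨0, by rintro _ ⟨z, -, rfl⟩; exact norm_nonneg z⟩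
  have hdle : ∀ n, ∀ z ∈ C n, d n ≤ ‖z‖ := fun n z hz => csInf_le (hbdd n) ⟨z, hz, rfl⟩
  have hdmono : Monotone d := fun m n hmn =>
    csInf_le_csInf (hbdd m) ((hne n).image _) (Set.image_mono (hanti hmn))
  have hdr : ∀ n, d n ≤ r₀ := fun n =>
    ge_of_tendsto hr ((hev n).mono fun m hm => (hdle n _ hm).trans (hy m))
  have hdlim : Tendsto d atTop (𝓝 (⨆ n, d n)) :=
    tendsto_atTop_ciSup hdmono ⟨r₀, by rintro _ ⟨n, rfl⟩; exact hdr n⟩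
  set D := ⨆ n, d n with hD
  have hDr : D ≤ r₀ := ciSup_le hdr
  have hdD : ∀ n, d n ≤ D := fun n => le_ciSup ⟨r₀, by rintro _ ⟨n, rfl⟩; exact hdr n⟩ n
  have hex : ∀ n : ℕ, ∃ z ∈ C n, ‖z‖ < d n + 1 / ((n : ℝ) + 1) := by
    intro n
    have hpos : 0 < 1 / ((n : ℝ) + 1) := by positivity
    obtain ⟨_, ⟨z, hz, rfl⟩, hlt⟩ := Real.lt_sInf_add_pos ((hne n).image norm) hpos
    exact ⟨z, hz, hlt⟩
  choose z hzC hzd using hex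
  have hcauchy : CauchySeq z := by
    rw [Metric.cauchySeq_iff]
    intro ε hε
    obtain ⟨δ, hδ, huc⟩ :=
      exists_forall_closed_ball_dist_add_le_two_mul_sub Y (half_pos hε) D
    have hD0 : 0 ≤ D := (Real.sInf_nonneg (by
      rintro _ ⟨w, -, rfl⟩; exact norm_nonneg w)).trans (hdD 0)
    -- Points of norm at most `D + η` are moved into the ball of radius `D` by a homothety.
    have hshrink : ∀ η, 0 < η → ∀ w : Y, ‖w‖ ≤ D + η → ∃ w', ‖w'‖ ≤ D ∧ ‖w - w'‖ ≤ η := by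
      intro η hη w hw
      have hpos : 0 < D + η := by linarith
      refine ⟨(D / (D + η)) • w, ?_, ?_⟩
      · rw [norm_smul, Real.norm_of_nonneg (by positivity), div_mul_eq_mul_div,
          div_le_iff₀ hpos]
        gcongr
      · have h : w - (D / (D + η)) • w = (η / (D + η)) • w := by
          have : η / (D + η) = 1 - D / (D + η) := by field_simp; ring
          rw [this, sub_smul, one_smul]
        rw [h, norm_smul, Real.norm_of_nonneg (by positivity), div_mul_eq_mul_div,
          div_le_iff₀ hpos]
        gcongr
    set η := min (ε / 8) (δ / 8) with hη
    have hη0 : 0 < η := by positivity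
    have hη1 : η ≤ ε / 8 := min_le_left _ _
    have hη2 : η ≤ δ / 8 := min_le_right _ _
    obtain ⟨n₁, hn₁⟩ := ((tendsto_order.1 hdlim).1 (D - δ / 4) (by linarith)).exists
    obtain ⟨n₂, hn₂⟩ := eventually_atTop.1
      ((tendsto_order.1 (tendsto_one_div_add_atTop_nhds_zero_nat (𝕜 := ℝ))).2 η hη0)
    have hz : ∀ n, n₂ ≤ n → ‖z n‖ ≤ D + η := fun n hn => by
      linarith [hn₂ n hn, hzd n, hdD n]
    refine ⟨max n₁ n₂, fun n hn m hm => ?_⟩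
    by_contra! hcon
    rw [dist_eq_norm] at hcon
    obtain ⟨u, hu, hun⟩ := hshrink η hη0 _ (hz n (le_of_max_le_right hn))
    obtain ⟨v, hv, hvm⟩ := hshrink η hη0 _ (hz m (le_of_max_le_right hm))
    have huv : ε / 2 ≤ ‖u - v‖ := by
      have h : z n - z m = (z n - u) + (u - v) - (z m - v) := by abel
      have h1 := norm_sub_le ((z n - u) + (u - v)) (z m - v)
      have h2 := norm_add_le (z n - u) (u - v)
      rw [← h] at h1
      linarith
    have hsum : ‖z n + z m‖ ≤ 2 * D - δ + 2 * η := by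
      have h : z n + z m = (z n - u) + (u + v) + (z m - v) := by abel
      have h1 := norm_add_le ((z n - u) + (u + v)) (z m - v)
      have h2 := norm_add_le (z n - u) (u + v)
      rw [← h] at h1
      linarith [huc hu hv huv]
    have hlow := hdle n₁ _ (hmid n₁ _ (hanti (le_of_max_le_left hn) (hzC n)) _
      (hanti (le_of_max_le_left hm) (hzC m)))
    rw [norm_smul] at hlow
    norm_num at hlow
    linarith
  obtain ⟨y₀, hy₀⟩ := cauchySeq_tendsto_of_complete hcauchy
  choose x' hx' hzK using hzC
  refine ⟨y₀, ?_, ?_⟩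
  · have hx'lim : Tendsto x' atTop (𝓝 x₀) := by
      rw [tendsto_iff_norm_sub_tendsto_zero]
      exact squeeze_zero (fun _ => norm_nonneg _) hx' tendsto_one_div_add_atTop_nhds_zero_nat
    exact hKc.mem_of_tendsto (hx'lim.prodMk_nhds hy₀) (Eventually.of_forall hzK)
  · refine le_trans ?_ hDr
    have := hdlim.add (tendsto_one_div_add_atTop_nhds_zero_nat (𝕜 := ℝ))
    rw [add_zero] at this
    exact le_of_tendsto_of_tendsto' hy₀.norm this fun n => (hzd n).le

/-! ### The space `W_0^{1,p}(Ω)` as a closed subspace of `L^p × L^p` -/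

section TestFunctions

variable {N : ℕ} {Ω : Opens (EuclideanSpace ℝ (Fin N))}

theorem contDiff_testFunction (φ : 𝓓(Ω, ℝ)) (n : ℕ∞) : ContDiff ℝ n φ :=
  φ.contDiff.of_le (by exact_mod_cast le_top)

theorem differentiable_testFunction (φ : 𝓓(Ω, ℝ)) : Differentiable ℝ φ :=
  (contDiff_testFunction φ 1).differentiable (by simp)

theorem continuous_fderiv_testFunction (φ : 𝓓(Ω, ℝ)) : Continuous (fderiv ℝ φ) :=
  (contDiff_testFunction φ 1).continuous_fderiv (by simp)

theorem continuous_gradient_testFunction (φ : 𝓓(Ω, ℝ)) : Continuous (gradient φ) :=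
  (InnerProductSpace.toDual ℝ (EuclideanSpace ℝ (Fin N))).symm.continuous.comp
    (continuous_fderiv_testFunction φ)

theorem hasCompactSupport_gradient_testFunction (φ : 𝓓(Ω, ℝ)) : HasCompactSupport (gradient φ) :=
  (φ.hasCompactSupport.fderiv (𝕜 := ℝ)).comp_left
    (g := (InnerProductSpace.toDual ℝ (EuclideanSpace ℝ (Fin N))).symm) (map_zero _)

theorem gradient_testFunction_apply (φ : 𝓓(Ω, ℝ)) (x : EuclideanSpace ℝ (Fin N)) (i : Fin N) :
    gradient φ x i = fderiv ℝ φ x (EuclideanSpace.single i 1) := by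
  rw [gradient, ← InnerProductSpace.toDual_symm_apply, EuclideanSpace.inner_single_right]
  simp

theorem norm_gradient_testFunction (φ : 𝓓(Ω, ℝ)) (x : EuclideanSpace ℝ (Fin N)) :
    ‖gradient φ x‖ = ‖fderiv ℝ φ x‖ := by
  rw [gradient, LinearIsometryEquiv.norm_map]

theorem testFunction_eq_zero (φ : 𝓓(Ω, ℝ)) {x : EuclideanSpace ℝ (Fin N)}
    (hx : x ∉ (Ω : Set (EuclideanSpace ℝ (Fin N)))) : φ x = 0 :=
  image_eq_zero_of_notMem_tsupport fun h => hx (φ.tsupport_subset h)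

theorem fderiv_testFunction_eq_zero (φ : 𝓓(Ω, ℝ)) {x : EuclideanSpace ℝ (Fin N)}
    (hx : x ∉ (Ω : Set (EuclideanSpace ℝ (Fin N)))) : fderiv ℝ φ x = 0 :=
  image_eq_zero_of_notMem_tsupport fun h => hx (φ.tsupport_subset (tsupport_fderiv_subset ℝ h))

theorem memLp_testFunction (φ : 𝓓(Ω, ℝ)) (q : ℝ≥0∞) :
    MemLp φ q (volume.restrict (Ω : Set (EuclideanSpace ℝ (Fin N)))) :=
  φ.continuous.memLp_of_hasCompactSupport φ.hasCompactSupport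

theorem memLp_gradient_testFunction (φ : 𝓓(Ω, ℝ)) (q : ℝ≥0∞) :
    MemLp (gradient φ) q (volume.restrict (Ω : Set (EuclideanSpace ℝ (Fin N)))) :=
  (continuous_gradient_testFunction φ).memLp_of_hasCompactSupport
    (hasCompactSupport_gradient_testFunction φ)

theorem gradient_testFunction_add (φ ψ : 𝓓(Ω, ℝ)) :
    gradient (φ + ψ : 𝓓(Ω, ℝ)) = gradient φ + gradient ψ := by
  funext x
  rw [Pi.add_apply, gradient, gradient, gradient, ← map_add, FunLike.coe_add,
    fderiv_add (differentiable_testFunction φ x) (differentiable_testFunction ψ x)]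

theorem gradient_testFunction_smul (c : ℝ) (φ : 𝓓(Ω, ℝ)) :
    gradient (c • φ : 𝓓(Ω, ℝ)) = c • gradient φ := by
  funext x
  rw [Pi.smul_apply, gradient, gradient, FunLike.coe_smul,
    fderiv_const_smul (differentiable_testFunction φ x), map_smulₛₗ]
  simp

/-- A function that is smooth on the whole space is integrated by parts against a test function
without boundary terms, also when the domain of integration is `Ω`. -/
theorem setIntegral_mul_fderiv_testFunction {f : EuclideanSpace ℝ (Fin N) → ℝ}
    (hf : ContDiff ℝ 1 f) (ψ : 𝓓(Ω, ℝ)) (v : EuclideanSpace ℝ (Fin N)) :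
    ∫ x in (Ω : Set (EuclideanSpace ℝ (Fin N))), f x * fderiv ℝ ψ x v =
      -∫ x in (Ω : Set (EuclideanSpace ℝ (Fin N))), fderiv ℝ f x v * ψ x := by
  rw [setIntegral_eq_integral_of_forall_compl_eq_zero fun x hx => by
      rw [fderiv_testFunction_eq_zero ψ hx]; simp,
    setIntegral_eq_integral_of_forall_compl_eq_zero fun x hx => by
      rw [testFunction_eq_zero ψ hx]; simp]
  have hψ' : Continuous fun x => fderiv ℝ ψ x v :=
    (continuous_fderiv_testFunction ψ).clm_apply continuous_const
  have hf' : Continuous fun x => fderiv ℝ f x v :=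
    (hf.continuous_fderiv (by simp)).clm_apply continuous_const
  refine integral_mul_fderiv_eq_neg_fderiv_mul_of_integrable ?_ ?_ ?_
    (fun x _ => hf.differentiable (by simp) x) (fun x _ => differentiable_testFunction ψ x)
  · exact (hf'.mul ψ.continuous).integrable_of_hasCompactSupport ψ.hasCompactSupport.mul_left
  · exact (hf.continuous.mul hψ').integrable_of_hasCompactSupport
      (ψ.hasCompactSupport.fderiv_apply (𝕜 := ℝ) v).mul_left
  · exact (hf.continuous.mul ψ.continuous).integrable_of_hasCompactSupport
      ψ.hasCompactSupport.mul_left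

end TestFunctions

section SobolevZero

variable {N : ℕ} (Ω : Opens (EuclideanSpace ℝ (Fin N))) (p : ℝ) [Fact (1 ≤ ENNReal.ofReal p)]

/-- The linear map `φ ↦ (φ, ∇φ)` from `C_c^∞(Ω)` to `L^p(Ω) × L^p(Ω; ℝ^N)`. -/
noncomputable def testPair : 𝓓(Ω, ℝ) →ₗ[ℝ]
    Lp ℝ (ENNReal.ofReal p) (volume.restrict (Ω : Set (EuclideanSpace ℝ (Fin N)))) ×
    Lp (EuclideanSpace ℝ (Fin N)) (ENNReal.ofReal p)
      (volume.restrict (Ω : Set (EuclideanSpace ℝ (Fin N)))) where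
  toFun φ := ((memLp_testFunction φ _).toLp φ, (memLp_gradient_testFunction φ _).toLp (gradient φ))
  map_add' φ ψ := by
    rw [Prod.mk_add_mk, ← MemLp.toLp_add, ← MemLp.toLp_add]
    simp only [gradient_testFunction_add]
    rfl
  map_smul' c φ := by
    rw [RingHom.id_apply, Prod.smul_mk, ← MemLp.toLp_const_smul, ← MemLp.toLp_const_smul]
    simp only [gradient_testFunction_smul]
    rfl

/-- `W_0^{1,p}(Ω)`, realised as the closed subspace of pairs `(u, ∇u)` in
`L^p(Ω) × L^p(Ω; ℝ^N)`. -/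
noncomputable def sobolevZero : Submodule ℝ
    (Lp ℝ (ENNReal.ofReal p) (volume.restrict (Ω : Set (EuclideanSpace ℝ (Fin N)))) ×
    Lp (EuclideanSpace ℝ (Fin N)) (ENNReal.ofReal p)
      (volume.restrict (Ω : Set (EuclideanSpace ℝ (Fin N))))) :=
  (LinearMap.range (testPair Ω p)).topologicalClosure

variable {Ω p}

theorem edist_toLp_testPair {u : EuclideanSpace ℝ (Fin N) → ℝ}
    {G : EuclideanSpace ℝ (Fin N) → EuclideanSpace ℝ (Fin N)}
    (hu : MemLp u (ENNReal.ofReal p) (volume.restrict (Ω : Set (EuclideanSpace ℝ (Fin N)))))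
    (hG : MemLp G (ENNReal.ofReal p) (volume.restrict (Ω : Set (EuclideanSpace ℝ (Fin N)))))
    (φ : 𝓓(Ω, ℝ)) :
    edist (hu.toLp u, hG.toLp G) (testPair Ω p φ) =
      max (eLpNorm (fun x => u x - φ x) (ENNReal.ofReal p)
        (volume.restrict (Ω : Set (EuclideanSpace ℝ (Fin N)))))
      (eLpNorm (fun x => G x - gradient φ x) (ENNReal.ofReal p)
        (volume.restrict (Ω : Set (EuclideanSpace ℝ (Fin N))))) := by
  rw [Prod.edist_eq]
  exact congrArg₂ max (Lp.edist_toLp_toLp _ _ hu (memLp_testFunction φ _))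
    (Lp.edist_toLp_toLp _ _ hG (memLp_gradient_testFunction φ _))

theorem toLp_mem_sobolevZero_iff {u : EuclideanSpace ℝ (Fin N) → ℝ}
    {G : EuclideanSpace ℝ (Fin N) → EuclideanSpace ℝ (Fin N)}
    (hu : MemLp u (ENNReal.ofReal p) (volume.restrict (Ω : Set (EuclideanSpace ℝ (Fin N)))))
    (hG : MemLp G (ENNReal.ofReal p) (volume.restrict (Ω : Set (EuclideanSpace ℝ (Fin N))))) :
    (hu.toLp u, hG.toLp G) ∈ sobolevZero Ω p ↔ ∀ ε : ℝ≥0∞, 0 < ε → ∃ φ : 𝓓(Ω, ℝ),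
      eLpNorm (fun x => u x - φ x) (ENNReal.ofReal p)
        (volume.restrict (Ω : Set (EuclideanSpace ℝ (Fin N)))) +
      eLpNorm (fun x => G x - gradient φ x) (ENNReal.ofReal p)
        (volume.restrict (Ω : Set (EuclideanSpace ℝ (Fin N)))) < ε := by
  rw [sobolevZero, ← SetLike.mem_coe, Submodule.topologicalClosure_coe, EMetric.mem_closure_iff]
  constructor
  · intro h ε hε
    obtain ⟨_, ⟨φ, rfl⟩, hφ⟩ := h (ε / 2) (ENNReal.half_pos hε.ne')
    rw [edist_toLp_testPair, max_lt_iff] at hφ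
    exact ⟨φ, (ENNReal.add_lt_add hφ.1 hφ.2).trans_le (ENNReal.add_halves ε).le⟩
  · intro h ε hε
    obtain ⟨φ, hφ⟩ := h ε hε
    refine ⟨_, ⟨φ, rfl⟩, ?_⟩
    rw [edist_toLp_testPair]
    exact (max_le le_self_add le_add_self).trans_lt hφ

theorem MemW01p.toLp_mem_sobolevZero {u : EuclideanSpace ℝ (Fin N) → ℝ}
    {G : EuclideanSpace ℝ (Fin N) → EuclideanSpace ℝ (Fin N)} (h : MemW01p Ω p u G) :
    (h.memLp.toLp u, h.memLp_grad.toLp G) ∈ sobolevZero Ω p :=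
  (toLp_mem_sobolevZero_iff _ _).2 h.mem_closure

end SobolevZero

section Limits

/-- A product of a uniformly bounded factor converging almost everywhere and a factor converging in
`L^1` may be integrated in the limit. -/
theorem tendsto_integral_mul_of_bdd {α : Type*} [MeasurableSpace α] {μ : Measure α}
    {f : ℕ → α → ℝ} {f₀ : α → ℝ} {g : ℕ → α → ℝ} {g₀ : α → ℝ} {C : ℝ}
    (hfm : ∀ n, AEStronglyMeasurable (f n) μ) (hfC : ∀ n x, ‖f n x‖ ≤ C)
    (hf : ∀ᵐ x ∂μ, Tendsto (fun n => f n x) atTop (𝓝 (f₀ x)))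
    (hgi : ∀ n, Integrable (g n) μ) (hg₀ : Integrable g₀ μ)
    (hg : Tendsto (fun n => eLpNorm (fun x => g₀ x - g n x) 1 μ) atTop (𝓝 0)) :
    Tendsto (fun n => ∫ x, f n x * g n x ∂μ) atTop (𝓝 (∫ x, f₀ x * g₀ x ∂μ)) := by
  have h1 : Tendsto (fun n => ∫ x, f n x * g₀ x ∂μ) atTop (𝓝 (∫ x, f₀ x * g₀ x ∂μ)) := by
    refine tendsto_integral_of_dominated_convergence (fun x => C * ‖g₀ x‖)
      (fun n => (hfm n).mul hg₀.1) (hg₀.norm.const_mul C) (fun n => ?_) ?_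
    · refine Eventually.of_forall fun x => ?_
      rw [norm_mul]
      exact mul_le_mul_of_nonneg_right (hfC n x) (norm_nonneg _)
    · filter_upwards [hf] with x hx using hx.mul_const _
  have hint : ∀ n, Integrable (fun x => f n x * (g₀ x - g n x)) μ := fun n =>
    (hg₀.sub (hgi n)).bdd_mul (hfm n) (Eventually.of_forall (hfC n))
  have h2 : Tendsto (fun n => ∫ x, f n x * (g₀ x - g n x) ∂μ) atTop (𝓝 0) := by
    have hlim : Tendsto (fun n => C * (eLpNorm (fun x => g₀ x - g n x) 1 μ).toReal) atTop
        (𝓝 0) := by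
      simpa using ((ENNReal.tendsto_toReal ENNReal.zero_ne_top).comp hg).const_mul C
    refine squeeze_zero_norm (fun n => ?_) hlim
    have hi : Integrable (fun x => g₀ x - g n x) μ := hg₀.sub (hgi n)
    rw [toReal_eLpNorm hi.1, lpNorm_one_eq_integral_norm hi.1, ← integral_const_mul]
    refine norm_integral_le_of_norm_le (hi.norm.const_mul C) (Eventually.of_forall fun x => ?_)
    rw [norm_mul]
    exact mul_le_mul_of_nonneg_right (hfC n x) (norm_nonneg _)
  have h3 : ∀ n, ∫ x, f n x * g n x ∂μ =
      ∫ x, f n x * g₀ x ∂μ - ∫ x, f n x * (g₀ x - g n x) ∂μ := by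
    intro n
    rw [← integral_sub (hg₀.bdd_mul (hfm n) (Eventually.of_forall (hfC n))) (hint n)]
    congr 1
    funext x
    ring
  simp_rw [h3]
  simpa using h1.sub h2

variable {N : ℕ} {Ω : Opens (EuclideanSpace ℝ (Fin N))} {p : ℝ}

/-- On a bounded open set, a pair in the closure of `C_c^∞(Ω)` is the limit of a sequence of test
functions in the sense that suffices for passing to the limit under integrals. -/
theorem exists_seq_testFunction (hp : 1 < p)
    [IsFiniteMeasure (volume.restrict (Ω : Set (EuclideanSpace ℝ (Fin N))))]
    {u : EuclideanSpace ℝ (Fin N) → ℝ}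
    {G : EuclideanSpace ℝ (Fin N) → EuclideanSpace ℝ (Fin N)}
    (hu : MemLp u (ENNReal.ofReal p) (volume.restrict (Ω : Set (EuclideanSpace ℝ (Fin N)))))
    (hG : MemLp G (ENNReal.ofReal p) (volume.restrict (Ω : Set (EuclideanSpace ℝ (Fin N)))))
    (h : ∀ ε : ℝ≥0∞, 0 < ε → ∃ φ : 𝓓(Ω, ℝ),
      eLpNorm (fun x => u x - φ x) (ENNReal.ofReal p)
        (volume.restrict (Ω : Set (EuclideanSpace ℝ (Fin N)))) +
      eLpNorm (fun x => G x - gradient φ x) (ENNReal.ofReal p)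
        (volume.restrict (Ω : Set (EuclideanSpace ℝ (Fin N)))) < ε) :
    ∃ φ : ℕ → 𝓓(Ω, ℝ),
      Tendsto (fun n => eLpNorm (fun x => u x - φ n x) 1
        (volume.restrict (Ω : Set (EuclideanSpace ℝ (Fin N))))) atTop (𝓝 0) ∧
      (∀ i : Fin N, Tendsto (fun n => eLpNorm (fun x => G x i - gradient (φ n) x i) 1
        (volume.restrict (Ω : Set (EuclideanSpace ℝ (Fin N))))) atTop (𝓝 0)) ∧
      ∀ᵐ x ∂volume.restrict (Ω : Set (EuclideanSpace ℝ (Fin N))),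
        Tendsto (fun n => φ n x) atTop (𝓝 (u x)) := by
  set μ := volume.restrict (Ω : Set (EuclideanSpace ℝ (Fin N))) with hμ
  have hp1 : 1 ≤ ENNReal.ofReal p := by simpa using hp.le
  choose φ hφ using fun n : ℕ => h ((n : ℝ≥0∞) + 1)⁻¹ (by simp)
  have hlim : Tendsto (fun n : ℕ => ((n : ℝ≥0∞) + 1)⁻¹) atTop (𝓝 0) := by
    have := ENNReal.tendsto_inv_nat_nhds_zero.comp (tendsto_add_atTop_nat 1)
    simpa [Function.comp_def] using this
  set c : ℝ≥0∞ := μ Set.univ ^ (1 / (1 : ℝ≥0∞).toReal - 1 / (ENNReal.ofReal p).toReal) with hc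
  have hc_top : c ≠ ∞ := by
    refine ENNReal.rpow_ne_top_of_nonneg ?_ (measure_ne_top _ _)
    rw [ENNReal.toReal_ofReal (by linarith), ENNReal.toReal_one, sub_nonneg]
    rw [div_le_div_iff₀ (by linarith) one_pos]
    linarith
  have hlimc : Tendsto (fun n : ℕ => ((n : ℝ≥0∞) + 1)⁻¹ * c) atTop (𝓝 0) := by
    simpa using ENNReal.Tendsto.mul_const hlim (Or.inr hc_top)
  have hu1 : Tendsto (fun n => eLpNorm (fun x => u x - φ n x) 1 μ) atTop (𝓝 0) := by
    refine tendsto_of_tendsto_of_tendsto_of_le_of_le tendsto_const_nhds hlimc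
      (fun _ => zero_le) fun n => ?_
    refine (eLpNorm_le_eLpNorm_mul_rpow_measure_univ hp1
      (hu.1.sub (memLp_testFunction (φ n) 1).1)).trans ?_
    gcongr
    exact le_self_add.trans (hφ n).le
  -- Convergence almost everywhere holds along a subsequence.
  obtain ⟨ns, hns, hae⟩ := (tendstoInMeasure_of_tendsto_eLpNorm one_ne_zero
    (fun n => (memLp_testFunction (φ n) 1).1) hu.1 (f := fun n => φ n) (by
      refine hu1.congr fun n => ?_
      rw [← eLpNorm_neg]
      congr 1
      funext x
      simp)).exists_seq_tendsto_ae
  refine ⟨fun n => φ (ns n), hu1.comp hns.tendsto_atTop, fun i => ?_, hae⟩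
  have hG1 : Tendsto (fun n => eLpNorm (fun x => G x i - gradient (φ n) x i) 1 μ) atTop (𝓝 0) := by
    refine tendsto_of_tendsto_of_tendsto_of_le_of_le tendsto_const_nhds hlimc
      (fun _ => zero_le) fun n => ?_
    refine (eLpNorm_mono (g := fun x => G x - gradient (φ n) x) fun x => ?_).trans
      ((eLpNorm_le_eLpNorm_mul_rpow_measure_univ hp1
        (hG.1.sub (memLp_gradient_testFunction (φ n) 1).1)).trans ?_)
    · exact PiLp.norm_apply_le (G x - gradient (φ n) x) i
    · gcongr
      exact le_add_self.trans (hφ n).le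
  exact hG1.comp hns.tendsto_atTop

theorem integrable_apply_of_memLp (hp : 1 < p)
    [IsFiniteMeasure (volume.restrict (Ω : Set (EuclideanSpace ℝ (Fin N))))]
    {G : EuclideanSpace ℝ (Fin N) → EuclideanSpace ℝ (Fin N)}
    (hG : MemLp G (ENNReal.ofReal p) (volume.restrict (Ω : Set (EuclideanSpace ℝ (Fin N)))))
    (i : Fin N) :
    Integrable (fun x => G x i) (volume.restrict (Ω : Set (EuclideanSpace ℝ (Fin N)))) :=
  ContinuousLinearMap.integrable_comp (EuclideanSpace.proj i : EuclideanSpace ℝ (Fin N) →L[ℝ] ℝ)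
    (hG.integrable (by simpa using hp.le))

/-- The weak gradient is recovered from membership in the closure of `C_c^∞(Ω)`. -/
theorem memW01p_of_toLp_mem (hp : 1 < p) [Fact (1 ≤ ENNReal.ofReal p)]
    [IsFiniteMeasure (volume.restrict (Ω : Set (EuclideanSpace ℝ (Fin N))))]
    {u : EuclideanSpace ℝ (Fin N) → ℝ}
    {G : EuclideanSpace ℝ (Fin N) → EuclideanSpace ℝ (Fin N)}
    (hu : MemLp u (ENNReal.ofReal p) (volume.restrict (Ω : Set (EuclideanSpace ℝ (Fin N)))))
    (hG : MemLp G (ENNReal.ofReal p) (volume.restrict (Ω : Set (EuclideanSpace ℝ (Fin N)))))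
    (h : (hu.toLp u, hG.toLp G) ∈ sobolevZero Ω p) : MemW01p Ω p u G := by
  have hcl := (toLp_mem_sobolevZero_iff hu hG).1 h
  have hp1 : 1 ≤ ENNReal.ofReal p := by simpa using hp.le
  have hui := hu.integrable hp1
  have hGi := hG.integrable hp1
  refine ⟨⟨⟨IntegrableOn.locallyIntegrableOn hui, IntegrableOn.locallyIntegrableOn hGi, ?_⟩,
    hu, hG⟩, hcl⟩
  intro ψ i
  obtain ⟨φ, hφ, hφG, -⟩ := exists_seq_testFunction hp hu hG hcl
  have hψ' : Continuous fun x => fderiv ℝ ψ x (EuclideanSpace.single i 1) :=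
    (continuous_fderiv_testFunction ψ).clm_apply continuous_const
  obtain ⟨C₁, hC₁⟩ := hψ'.bounded_above_of_compact_support
    (ψ.hasCompactSupport.fderiv_apply (𝕜 := ℝ) _)
  obtain ⟨C₂, hC₂⟩ := ψ.continuous.bounded_above_of_compact_support ψ.hasCompactSupport
  have h1 := tendsto_integral_mul_of_bdd (f := fun _ x => fderiv ℝ ψ x (EuclideanSpace.single i 1))
    (fun _ => hψ'.aestronglyMeasurable) (fun _ => hC₁)
    (Eventually.of_forall fun x => tendsto_const_nhds)
    (fun n => (memLp_testFunction (φ n) 1).integrable le_rfl) hui hφ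
  have h2 := tendsto_integral_mul_of_bdd (f := fun _ => ψ)
    (fun _ => ψ.continuous.aestronglyMeasurable) (fun _ => hC₂)
    (Eventually.of_forall fun x => tendsto_const_nhds)
    (fun n => ContinuousLinearMap.integrable_comp
      (EuclideanSpace.proj i : EuclideanSpace ℝ (Fin N) →L[ℝ] ℝ)
      ((memLp_gradient_testFunction (φ n) 1).integrable le_rfl))
    (integrable_apply_of_memLp hp hG i) (hφG i)
  have h3 : ∀ n, ∫ x in (Ω : Set (EuclideanSpace ℝ (Fin N))),
      fderiv ℝ ψ x (EuclideanSpace.single i 1) * φ n x =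
      -∫ x in (Ω : Set (EuclideanSpace ℝ (Fin N))), ψ x * gradient (φ n) x i := by
    intro n
    have := setIntegral_mul_fderiv_testFunction (contDiff_testFunction (φ n) 1) ψ
      (EuclideanSpace.single i 1)
    simp_rw [gradient_testFunction_apply, mul_comm (ψ _)]
    rw [← this]
    simp_rw [mul_comm]
  have := tendsto_nhds_unique (h1.congr h3) h2.neg
  simp_rw [mul_comm (u _), mul_comm (G _ _)]
  exact this

/-- **Stampacchia's lemma**: the gradient of a function of `W_0^{1,p}(Ω)` vanishes almost
everywhere on its zero set. Testing the bounded functions `δ arctan (u / δ)`, which tend uniformly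
to `0` while their gradients `(1 + (u / δ)²)⁻¹ ∇u` tend to `1_{u = 0} ∇u`, shows that
`1_{u = 0} ∇u` is orthogonal to every test function. -/
theorem MemW01p.ae_grad_eq_zero (hp : 1 < p)
    [IsFiniteMeasure (volume.restrict (Ω : Set (EuclideanSpace ℝ (Fin N))))]
    {u : EuclideanSpace ℝ (Fin N) → ℝ}
    {G : EuclideanSpace ℝ (Fin N) → EuclideanSpace ℝ (Fin N)} (h : MemW01p Ω p u G) :
    ∀ᵐ x ∂volume.restrict (Ω : Set (EuclideanSpace ℝ (Fin N))), u x = 0 → G x = 0 := by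
  classical
  obtain ⟨φ, hφ, hφG, hae⟩ := exists_seq_testFunction hp h.memLp h.memLp_grad h.mem_closure
  have hGi := integrable_apply_of_memLp hp h.memLp_grad
  have hone : ∀ t : ℝ, ‖(1 + t ^ 2)⁻¹‖ ≤ 1 := fun t => by
    rw [Real.norm_of_nonneg (by positivity)]
    exact inv_le_one_of_one_le₀ (by nlinarith [sq_nonneg t])
  have hcont : Continuous fun t : ℝ => (1 + t ^ 2)⁻¹ :=
    (by fun_prop : Continuous fun t : ℝ => 1 + t ^ 2).inv₀ fun t => by positivity
  have hbound : ∀ (i : Fin N) (ψ : 𝓓(Ω, ℝ)) (δ : ℝ), 0 < δ →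
      ‖∫ x in (Ω : Set (EuclideanSpace ℝ (Fin N))), (1 + (u x / δ) ^ 2)⁻¹ * ψ x * G x i‖ ≤
        δ * (Real.pi / 2 * ∫ x in (Ω : Set (EuclideanSpace ℝ (Fin N))),
          ‖fderiv ℝ ψ x (EuclideanSpace.single i 1)‖) := by
    intro i ψ δ hδ
    obtain ⟨C, hC⟩ := ψ.continuous.bounded_above_of_compact_support ψ.hasCompactSupport
    have hlim := tendsto_integral_mul_of_bdd (f := fun n x => (1 + (φ n x / δ) ^ 2)⁻¹ * ψ x)
      (f₀ := fun x => (1 + (u x / δ) ^ 2)⁻¹ * ψ x) (C := C)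
      (fun n => ((hcont.comp ((φ n).continuous.div_const δ)).mul
        ψ.continuous).aestronglyMeasurable)
      (fun n x => by
        rw [norm_mul]
        calc _ ≤ 1 * ‖ψ x‖ := mul_le_mul_of_nonneg_right (hone _) (norm_nonneg _)
          _ ≤ C := by simpa using hC x)
      (by
        filter_upwards [hae] with x hx
        exact ((hcont.tendsto _).comp (hx.div_const δ)).mul_const _)
      (fun n => ContinuousLinearMap.integrable_comp
        (EuclideanSpace.proj i : EuclideanSpace ℝ (Fin N) →L[ℝ] ℝ)
        ((memLp_gradient_testFunction (φ n) 1).integrable le_rfl))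
      (hGi i) (hφG i)
    refine le_of_tendsto hlim.norm (Eventually.of_forall fun n => ?_)
    have hF : ContDiff ℝ 1 fun x => δ * Real.arctan (φ n x / δ) :=
      contDiff_const.mul (((contDiff_testFunction (φ n) 1).div_const δ).arctan)
    have hF' : ∀ x, fderiv ℝ (fun x => δ * Real.arctan (φ n x / δ)) x (EuclideanSpace.single i 1) =
        (1 + (φ n x / δ) ^ 2)⁻¹ * gradient (φ n) x i := by
      intro x
      have hd := (((differentiable_testFunction (φ n) x).hasFDerivAt.mul_const
        δ⁻¹).arctan).const_mul δ
      simp_rw [← div_eq_mul_inv] at hd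
      rw [hd.fderiv, gradient_testFunction_apply]
      simp
      field_simp
    have hibp := setIntegral_mul_fderiv_testFunction hF ψ (EuclideanSpace.single i 1)
    simp_rw [hF'] at hibp
    have heq : ∫ x in (Ω : Set (EuclideanSpace ℝ (Fin N))),
        (1 + (φ n x / δ) ^ 2)⁻¹ * ψ x * gradient (φ n) x i =
        -∫ x in (Ω : Set (EuclideanSpace ℝ (Fin N))),
          δ * Real.arctan (φ n x / δ) * fderiv ℝ ψ x (EuclideanSpace.single i 1) := by
      rw [hibp, neg_neg]
      congr 1
      funext x
      ring
    refine (congrArg norm heq).trans_le ?_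
    rw [norm_neg, ← integral_const_mul, ← integral_const_mul]
    have hψ' : Continuous fun x => fderiv ℝ ψ x (EuclideanSpace.single i 1) :=
      (continuous_fderiv_testFunction ψ).clm_apply continuous_const
    have hψi : Integrable (fun x => fderiv ℝ ψ x (EuclideanSpace.single i 1))
        (volume.restrict (Ω : Set (EuclideanSpace ℝ (Fin N)))) :=
      hψ'.integrable_of_hasCompactSupport (ψ.hasCompactSupport.fderiv_apply (𝕜 := ℝ) _)
    refine norm_integral_le_of_norm_le ((hψi.norm.const_mul _).const_mul _)
      (Eventually.of_forall fun x => ?_)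
    rw [norm_mul, norm_mul, Real.norm_of_nonneg hδ.le, mul_assoc]
    gcongr
    rw [Real.norm_eq_abs, abs_le]
    exact ⟨(Real.neg_pi_div_two_lt_arctan _).le, (Real.arctan_lt_pi_div_two _).le⟩
  have hzero : ∀ (i : Fin N) (ψ : 𝓓(Ω, ℝ)),
      ∫ x in (Ω : Set (EuclideanSpace ℝ (Fin N))), ψ x • (if u x = 0 then G x i else 0) = 0 := by
    intro i ψ
    obtain ⟨C, hC⟩ := ψ.continuous.bounded_above_of_compact_support ψ.hasCompactSupport
    set δ : ℕ → ℝ := fun n => 1 / ((n : ℝ) + 1) with hδdef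
    have hδ0 : ∀ n, 0 < δ n := fun n => by positivity
    have hδ : Tendsto δ atTop (𝓝 0) := tendsto_one_div_add_atTop_nhds_zero_nat
    have h1 : Tendsto (fun n => ∫ x in (Ω : Set (EuclideanSpace ℝ (Fin N))),
        (1 + (u x / δ n) ^ 2)⁻¹ * ψ x * G x i) atTop
        (𝓝 (∫ x in (Ω : Set (EuclideanSpace ℝ (Fin N))),
          ψ x • (if u x = 0 then G x i else 0))) := by
      refine tendsto_integral_of_dominated_convergence (fun x => C * ‖G x i‖) (fun n => ?_)
        ((hGi i).norm.const_mul C) (fun n => Eventually.of_forall fun x => ?_)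
        (Eventually.of_forall fun x => ?_)
      · have hum : AEStronglyMeasurable (fun x => u x / δ n)
            (volume.restrict (Ω : Set (EuclideanSpace ℝ (Fin N)))) := by
          simpa [div_eq_mul_inv] using h.memLp.1.mul_const (δ n)⁻¹
        exact ((hcont.comp_aestronglyMeasurable hum).mul
          ψ.continuous.aestronglyMeasurable).mul (hGi i).1
      · rw [norm_mul, norm_mul]
        gcongr
        calc _ ≤ 1 * ‖ψ x‖ := mul_le_mul_of_nonneg_right (hone _) (norm_nonneg _)
          _ ≤ C := by simpa using hC x
      · by_cases hx : u x = 0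
        · simp [hx]
        · have hinf : Tendsto (fun n => 1 + (u x / δ n) ^ 2) atTop atTop := by
            refine tendsto_atTop_add_const_left _ _ ?_
            have heq : ∀ n, (u x / δ n) ^ 2 = u x ^ 2 * (((n : ℝ) + 1) ^ 2) := fun n => by
              simp only [hδdef]
              field_simp
            simp_rw [heq]
            refine Tendsto.const_mul_atTop (by positivity) ?_
            exact (tendsto_pow_atTop two_ne_zero).comp
              (tendsto_atTop_add_const_right _ _ tendsto_natCast_atTop_atTop)
          have := (hinf.inv_tendsto_atTop.mul_const (ψ x)).mul_const (G x i)
          simpa [hx] using this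
    have h2 : Tendsto (fun n => ∫ x in (Ω : Set (EuclideanSpace ℝ (Fin N))),
        (1 + (u x / δ n) ^ 2)⁻¹ * ψ x * G x i) atTop (𝓝 0) :=
      squeeze_zero_norm (fun n => hbound i ψ (δ n) (hδ0 n)) (by simpa using hδ.mul_const _)
    exact tendsto_nhds_unique h1 h2
  have hcomp : ∀ i : Fin N, ∀ᵐ x ∂volume.restrict (Ω : Set (EuclideanSpace ℝ (Fin N))),
      (if u x = 0 then G x i else 0) = 0 := by
    intro i
    have hm : AEStronglyMeasurable (fun x => if u x = 0 then G x i else 0)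
        (volume.restrict (Ω : Set (EuclideanSpace ℝ (Fin N)))) := by
      have hs : MeasurableSet {x | h.memLp.1.mk u x = 0} :=
        h.memLp.1.stronglyMeasurable_mk.measurable (measurableSet_singleton 0)
      refine ((hGi i).1.indicator hs).congr ?_
      filter_upwards [h.memLp.1.ae_eq_mk] with x hx
      simp [Set.indicator_apply, hx]
    have hint : IntegrableOn (fun x => if u x = 0 then G x i else 0)
        (Ω : Set (EuclideanSpace ℝ (Fin N))) := by
      refine (hGi i).mono hm (Eventually.of_forall fun x => ?_)
      split_ifs <;> simp
    rw [ae_restrict_iff' Ω.isOpen.measurableSet]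
    refine Ω.isOpen.ae_eq_zero_of_integral_contDiff_smul_eq_zero hint.locallyIntegrableOn ?_
    intro g hg hgc hgΩ
    refine Eq.trans (Eq.symm ?_) (hzero i ⟨g, hg, hgc, hgΩ⟩)
    refine setIntegral_eq_integral_of_forall_compl_eq_zero fun x hx => ?_
    rw [testFunction_eq_zero _ hx, zero_smul]
  filter_upwards [ae_all_iff.2 hcomp] with x hx hux
  ext i
  simpa [hux] using hx i

end Limits

/-! ### Compactness of the embedding of `W_0^{1,p}(Ω)` into `L^p(Ω)` -/

section Rellich

/-- Jensen's inequality for the function `t ↦ t ^ p` and a probability measure. -/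
theorem lintegral_rpow_le_of_isProbabilityMeasure {α : Type*} [MeasurableSpace α] {ν : Measure α}
    [IsProbabilityMeasure ν] {p : ℝ} (hp : 1 < p) {f : α → ℝ≥0∞} (hf : AEMeasurable f ν) :
    (∫⁻ x, f x ∂ν) ^ p ≤ ∫⁻ x, f x ^ p ∂ν := by
  have h := eLpNorm'_le_eLpNorm'_of_exponent_le one_pos hp.le ν hf.aestronglyMeasurable
  simp only [eLpNorm', enorm_eq_self, ENNReal.rpow_one, div_one, one_div] at h
  rwa [ENNReal.le_rpow_inv_iff (by linarith)] at h

theorem eLpNorm_ofReal_rpow {α F : Type*} [MeasurableSpace α] {μ : Measure α}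
    [NormedAddCommGroup F] {p : ℝ} (hp : 0 < p) (f : α → F) :
    eLpNorm f (ENNReal.ofReal p) μ ^ p = ∫⁻ x, ‖f x‖ₑ ^ p ∂μ := by
  rw [eLpNorm_eq_lintegral_rpow_enorm_toReal (by simpa using hp) ENNReal.ofReal_ne_top,
    ENNReal.toReal_ofReal hp.le, ← ENNReal.rpow_mul, one_div, inv_mul_cancel₀ hp.ne',
    ENNReal.rpow_one]

variable {V : Type*} [NormedAddCommGroup V] [NormedSpace ℝ V]

theorem enorm_sub_le_lintegral_fderiv {f : V → ℝ} (hf : ContDiff ℝ 1 f) (x h : V) :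
    ‖f (x + h) - f x‖ₑ ≤
      ∫⁻ t in Set.Ioc (0 : ℝ) 1, ‖fderiv ℝ f (x + t • h)‖ₑ * ‖h‖ₑ := by
  have hd : ∀ t : ℝ, HasDerivAt (fun t : ℝ => f (x + t • h)) (fderiv ℝ f (x + t • h) h) t := by
    intro t
    have h1 : HasDerivAt (fun t : ℝ => x + t • h) h t := by
      simpa using ((hasDerivAt_id t).smul_const h).const_add x
    exact (hf.differentiable (by simp) _).hasFDerivAt.comp_hasDerivAt t h1
  have hc : Continuous fun t : ℝ => fderiv ℝ f (x + t • h) h :=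
    ((hf.continuous_fderiv (by simp)).comp (by fun_prop)).clm_apply continuous_const
  have := intervalIntegral.integral_eq_sub_of_hasDerivAt (fun t _ => hd t)
    (hc.intervalIntegrable 0 1)
  simp only [one_smul, zero_smul, add_zero] at this
  rw [← this, intervalIntegral.integral_of_le zero_le_one]
  refine (enorm_integral_le_lintegral_enorm _).trans (lintegral_mono fun t => ?_)
  exact ContinuousLinearMap.le_opENorm _ _

variable [MeasurableSpace V] [BorelSpace V] [FiniteDimensional ℝ V] {μ : Measure V}
  [μ.IsAddHaarMeasure]

/-- Translation by `h` moves a `C^1` function in `L^p` by at most `‖h‖` times the `L^p` norm of its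
derivative. -/
theorem lintegral_translate_sub_le {p : ℝ} (hp : 1 < p) {f : V → ℝ} (hf : ContDiff ℝ 1 f) (h : V) :
    ∫⁻ x, ‖f (x + h) - f x‖ₑ ^ p ∂μ ≤ ‖h‖ₑ ^ p * ∫⁻ x, ‖fderiv ℝ f x‖ₑ ^ p ∂μ := by
  have hp0 : 0 ≤ p := by linarith
  have hfc : Continuous (fderiv ℝ f) := hf.continuous_fderiv (by simp)
  have : IsProbabilityMeasure ((volume : Measure ℝ).restrict (Set.Ioc (0 : ℝ) 1)) := ⟨by simp⟩
  have hm : Measurable fun z : V × ℝ => ‖fderiv ℝ f (z.1 + z.2 • h)‖ₑ ^ p :=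
    ((hfc.comp (by fun_prop : Continuous fun z : V × ℝ => z.1 + z.2 • h)).enorm.measurable
      ).pow_const p
  have hfm : Measurable fun x => ‖fderiv ℝ f x‖ₑ ^ p := hfc.enorm.measurable.pow_const p
  calc ∫⁻ x, ‖f (x + h) - f x‖ₑ ^ p ∂μ
      ≤ ∫⁻ x, (∫⁻ t in Set.Ioc (0 : ℝ) 1, ‖fderiv ℝ f (x + t • h)‖ₑ * ‖h‖ₑ) ^ p ∂μ :=
        lintegral_mono fun x =>
          ENNReal.rpow_le_rpow (enorm_sub_le_lintegral_fderiv hf x h) hp0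
    _ ≤ ∫⁻ x, (∫⁻ t in Set.Ioc (0 : ℝ) 1, ‖fderiv ℝ f (x + t • h)‖ₑ ^ p * ‖h‖ₑ ^ p) ∂μ := by
        refine lintegral_mono fun x => ?_
        have hmx : Measurable fun t : ℝ => ‖fderiv ℝ f (x + t • h)‖ₑ * ‖h‖ₑ :=
          ((hfc.comp (by fun_prop : Continuous fun t : ℝ => x + t • h)).enorm.measurable).mul_const
            _
        refine (lintegral_rpow_le_of_isProbabilityMeasure hp hmx.aemeasurable).trans_eq ?_
        simp_rw [ENNReal.mul_rpow_of_nonneg _ _ hp0]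
    _ = ∫⁻ t in Set.Ioc (0 : ℝ) 1, (∫⁻ x, ‖fderiv ℝ f (x + t • h)‖ₑ ^ p * ‖h‖ₑ ^ p ∂μ) :=
        lintegral_lintegral_swap (hm.mul_const _).aemeasurable
    _ = ∫⁻ _ in Set.Ioc (0 : ℝ) 1, (∫⁻ x, ‖fderiv ℝ f x‖ₑ ^ p ∂μ) * ‖h‖ₑ ^ p := by
        refine lintegral_congr fun t => ?_
        rw [lintegral_add_right_eq_self (μ := μ) (fun x => ‖fderiv ℝ f x‖ₑ ^ p * ‖h‖ₑ ^ p) (t • h),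
          lintegral_mul_const _ hfm]
    _ = ‖h‖ₑ ^ p * ∫⁻ x, ‖fderiv ℝ f x‖ₑ ^ p ∂μ := by
        rw [lintegral_const]
        simp [mul_comm]

variable (μ) in
/-- The `p`-th power mean oscillation of `f` around `x` at scale `r`. -/
noncomputable def meanOscillation (p r : ℝ) (f : V → ℝ) (x : V) : ℝ≥0∞ :=
  (μ (Metric.ball 0 r))⁻¹ * ∫⁻ h in Metric.ball (0 : V) (2 * r), ‖f (x + h) - f x‖ₑ ^ p ∂μ

theorem lintegral_meanOscillation_le {p : ℝ} (hp : 1 < p) {r : ℝ} (hr : 0 < r) {f : V → ℝ}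
    (hf : ContDiff ℝ 1 f) :
    ∫⁻ x, meanOscillation μ p r f x ∂μ ≤
      2 ^ Module.finrank ℝ V * ENNReal.ofReal (2 * r) ^ p * ∫⁻ x, ‖fderiv ℝ f x‖ₑ ^ p ∂μ := by
  have hp0 : 0 ≤ p := by linarith
  have hm : Measurable fun z : V × V => ‖f (z.1 + z.2) - f z.1‖ₑ ^ p := by
    have := hf.continuous
    exact (by fun_prop : Continuous fun z : V × V => f (z.1 + z.2) - f z.1)
      |>.enorm.measurable.pow_const p
  set I := ∫⁻ x, ‖fderiv ℝ f x‖ₑ ^ p ∂μ with hI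
  have hball0 : μ (Metric.ball (0 : V) r) ≠ 0 := (Metric.measure_ball_pos μ _ hr).ne'
  have hballt : μ (Metric.ball (0 : V) r) ≠ ∞ := measure_ball_lt_top.ne
  have hvol : μ (Metric.ball (0 : V) (2 * r)) = 2 ^ Module.finrank ℝ V * μ (Metric.ball 0 r) := by
    rw [Measure.addHaar_ball_mul_of_pos μ 0 two_pos, ENNReal.ofReal_pow zero_le_two]
    simp
  unfold meanOscillation
  rw [lintegral_const_mul _ (hm.lintegral_prod_right' (ν := μ.restrict _)),
    lintegral_lintegral_swap (hm.aemeasurable)]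
  calc (μ (Metric.ball 0 r))⁻¹ * ∫⁻ h in Metric.ball (0 : V) (2 * r),
        ∫⁻ x, ‖f (x + h) - f x‖ₑ ^ p ∂μ ∂μ
      ≤ (μ (Metric.ball 0 r))⁻¹ * ∫⁻ h in Metric.ball (0 : V) (2 * r),
        ENNReal.ofReal (2 * r) ^ p * I ∂μ := by
        gcongr 1
        refine setLIntegral_mono measurable_const fun h hh => ?_
        refine (lintegral_translate_sub_le hp hf h).trans ?_
        gcongr
        rw [← ofReal_norm]
        exact ENNReal.ofReal_le_ofReal (mem_ball_zero_iff.1 hh).le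
    _ = ((μ (Metric.ball 0 r))⁻¹ * μ (Metric.ball 0 r)) * (2 ^ Module.finrank ℝ V *
        ENNReal.ofReal (2 * r) ^ p * I) := by
        rw [setLIntegral_const, hvol]
        ring
    _ = _ := by rw [ENNReal.inv_mul_cancel hball0 hballt, one_mul]

theorem enorm_average_rpow_le {p : ℝ} (hp : 1 < p) {r : ℝ} (hr : 0 < r) {f : V → ℝ}
    (hf : Continuous f) (z : V) :
    ‖⨍ y in Metric.ball z r, f y ∂μ‖ₑ ^ p ≤
      (∫⁻ y in Metric.ball z r, ‖f y‖ₑ ^ p ∂μ) / μ (Metric.ball 0 r) := by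
  have hball0 : μ (Metric.ball z r) ≠ 0 := (Metric.measure_ball_pos μ _ hr).ne'
  have hne : NeZero (μ.restrict (Metric.ball z r)) := ⟨by simpa using hball0⟩
  have hfin : IsFiniteMeasure (μ.restrict (Metric.ball z r)) :=
    ⟨by simpa using measure_ball_lt_top⟩
  have hm : Measurable fun y => ‖f y‖ₑ := hf.enorm.measurable
  calc ‖⨍ y in Metric.ball z r, f y ∂μ‖ₑ ^ p
      ≤ (⨍⁻ y in Metric.ball z r, ‖f y‖ₑ ∂μ) ^ p :=
        ENNReal.rpow_le_rpow (enorm_integral_le_lintegral_enorm _) (by linarith)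
    _ ≤ ⨍⁻ y in Metric.ball z r, ‖f y‖ₑ ^ p ∂μ :=
        lintegral_rpow_le_of_isProbabilityMeasure hp hm.aemeasurable
    _ = _ := by rw [setLAverage_eq, Measure.addHaar_ball_center]

/-- The average of `f` over the ball of centre `z` and radius `r` replaces the value of `f` at a
point of that ball, at the cost of the mean oscillation. -/
theorem enorm_rpow_le_average_add_meanOscillation {p : ℝ} (hp : 1 < p) {r : ℝ} (hr : 0 < r)
    {f : V → ℝ} (hf : Continuous f) {x z : V} (hx : x ∈ Metric.ball z r) :
    ‖f x‖ₑ ^ p ≤ 2 ^ (p - 1) *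
      (meanOscillation μ p r f x + ‖⨍ y in Metric.ball z r, f y ∂μ‖ₑ ^ p) := by
  have hp0 : 0 ≤ p := by linarith
  have hball0 : μ (Metric.ball z r) ≠ 0 := (Metric.measure_ball_pos μ _ hr).ne'
  have hballt : μ (Metric.ball z r) ≠ ∞ := measure_ball_lt_top.ne
  have hne : NeZero (μ.restrict (Metric.ball z r)) := ⟨by simpa using hball0⟩
  have hfin : IsFiniteMeasure (μ.restrict (Metric.ball z r)) := ⟨by simpa using hballt.lt_top⟩
  have hfi : IntegrableOn f (Metric.ball z r) μ :=
    (hf.continuousOn.integrableOn_compact (isCompact_closedBall z r)).mono_set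
      Metric.ball_subset_closedBall
  have hmean : f x - ⨍ y in Metric.ball z r, f y ∂μ = ⨍ y in Metric.ball z r, (f x - f y) ∂μ := by
    rw [average, average, integral_sub (integrable_const _) (hfi.integrable.to_average),
      integral_const, probReal_univ, one_smul]
  have hosc : ‖f x - ⨍ y in Metric.ball z r, f y ∂μ‖ₑ ^ p ≤ meanOscillation μ p r f x := by
    calc ‖f x - ⨍ y in Metric.ball z r, f y ∂μ‖ₑ ^ p
        ≤ (μ (Metric.ball 0 r))⁻¹ * ∫⁻ y in Metric.ball z r, ‖f x - f y‖ₑ ^ p ∂μ := by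
          rw [hmean, ← ENNReal.div_eq_inv_mul]
          exact enorm_average_rpow_le hp hr (continuous_const.sub hf) z
      _ ≤ (μ (Metric.ball 0 r))⁻¹ * ∫⁻ y in Metric.ball x (2 * r), ‖f x - f y‖ₑ ^ p ∂μ := by
          gcongr
          refine Metric.ball_subset_ball' ?_
          rw [Metric.mem_ball, dist_comm] at hx
          linarith
      _ = meanOscillation μ p r f x := by
          rw [meanOscillation, ← lintegral_indicator Metric.isOpen_ball.measurableSet,
            ← lintegral_indicator Metric.isOpen_ball.measurableSet,
            ← lintegral_add_left_eq_self (μ := μ) _ x]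
          congr 1
          refine lintegral_congr fun h => ?_
          have hmem : x + h ∈ Metric.ball x (2 * r) ↔ h ∈ Metric.ball (0 : V) (2 * r) := by
            simp
          by_cases hh : h ∈ Metric.ball (0 : V) (2 * r)
          · rw [Set.indicator_of_mem hh, Set.indicator_of_mem (hmem.2 hh), enorm_sub_rev]
          · rw [Set.indicator_of_notMem hh, Set.indicator_of_notMem fun h' => hh (hmem.1 h')]
  calc ‖f x‖ₑ ^ p ≤ (‖f x - ⨍ y in Metric.ball z r, f y ∂μ‖ₑ +
        ‖⨍ y in Metric.ball z r, f y ∂μ‖ₑ) ^ p := by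
        refine ENNReal.rpow_le_rpow ?_ hp0
        simpa using enorm_add_le (f x - ⨍ y in Metric.ball z r, f y ∂μ)
          (⨍ y in Metric.ball z r, f y ∂μ)
    _ ≤ 2 ^ (p - 1) * (‖f x - ⨍ y in Metric.ball z r, f y ∂μ‖ₑ ^ p +
        ‖⨍ y in Metric.ball z r, f y ∂μ‖ₑ ^ p) :=
        ENNReal.rpow_add_le_mul_rpow_add_rpow _ _ hp.le
    _ ≤ _ := by gcongr

/-- If the averages of `f` over finitely many balls covering `s` are small, then so is `f` in
`L^p(s)`, up to the mean oscillation. -/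
theorem setLIntegral_rpow_le_of_average_le {p : ℝ} (hp : 1 < p) {r : ℝ} (hr : 0 < r) {f : V → ℝ}
    (hf : ContDiff ℝ 1 f) {s t : Set V} (hs : MeasurableSet s)
    (hst : s ⊆ ⋃ z ∈ t, Metric.ball z r) {η : ℝ≥0∞}
    (hη : ∀ z ∈ t, ‖⨍ y in Metric.ball z r, f y ∂μ‖ₑ ≤ η) :
    ∫⁻ x in s, ‖f x‖ₑ ^ p ∂μ ≤ 2 ^ (p - 1) * (2 ^ Module.finrank ℝ V * ENNReal.ofReal (2 * r) ^ p *
      (∫⁻ x, ‖fderiv ℝ f x‖ₑ ^ p ∂μ) + η ^ p * μ s) := by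
  have hp0 : 0 ≤ p := by linarith
  calc ∫⁻ x in s, ‖f x‖ₑ ^ p ∂μ
      ≤ ∫⁻ x in s, 2 ^ (p - 1) * (meanOscillation μ p r f x + η ^ p) ∂μ := by
        refine setLIntegral_mono' hs fun x hx => ?_
        obtain ⟨z, hz, hxz⟩ := Set.mem_iUnion₂.1 (hst hx)
        refine (enorm_rpow_le_average_add_meanOscillation (μ := μ) hp hr hf.continuous hxz).trans ?_
        gcongr
        exact hη z hz
    _ = 2 ^ (p - 1) * (∫⁻ x in s, meanOscillation μ p r f x ∂μ + η ^ p * μ s) := by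
        rw [lintegral_const_mul' _ _ (ENNReal.rpow_ne_top_of_nonneg (by linarith) (by simp)),
          lintegral_add_right _ measurable_const, setLIntegral_const]
    _ ≤ _ := by
        gcongr
        exact (setLIntegral_le_lintegral _ _).trans (lintegral_meanOscillation_le hp hr hf)

/-- A set is totally bounded if for each `ε` its elements are determined up to `ε` by data ranging
in a totally bounded set. -/
theorem totallyBounded_image_of_approx {ι : Type*} {X : Type} [PseudoMetricSpace X] {S : Set ι}
    {A : ι → X}
    (h : ∀ ε > (0 : ℝ), ∃ (Y : Type) (_ : PseudoMetricSpace Y) (B : ι → Y) (η : ℝ), 0 < η ∧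
      TotallyBounded (B '' S) ∧
      ∀ a ∈ S, ∀ b ∈ S, dist (B a) (B b) < η → dist (A a) (A b) < ε) :
    TotallyBounded (A '' S) := by
  refine Metric.totallyBounded_of_finite_discretization fun ε hε => ?_
  obtain ⟨Y, _, B, η, hη, hB, hAB⟩ := h ε hε
  obtain ⟨t, ht, htB⟩ := Metric.totallyBounded_iff.1 hB (η / 2) (half_pos hη)
  have hch : ∀ x : A '' S, ∃ (a : ι) (y : t), a ∈ S ∧ A a = x ∧ dist (B a) y < η / 2 := by
    rintro ⟨_, a, ha, rfl⟩
    obtain ⟨y, hy, hay⟩ := Set.mem_iUnion₂.1 (htB ⟨a, ha, rfl⟩)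
    exact ⟨a, ⟨y, hy⟩, ha, rfl, hay⟩
  choose a y ha hAa hay using hch
  refine ⟨t, ht.fintype, y, fun x x' hxx' => ?_⟩
  rw [← hAa x, ← hAa x']
  refine hAB _ (ha x) _ (ha x') ?_
  have h1 := hay x
  have h2 := hay x'
  rw [hxx'] at h1
  calc _ ≤ _ := dist_triangle_right _ _ _
    _ < η / 2 + η / 2 := add_lt_add h1 h2
    _ = η := add_halves η

theorem exists_pos_mul_rpow_lt {p : ℝ} (hp : 0 < p) {K c : ℝ} (hK : 0 ≤ K) (hc : 0 < c) :
    ∃ r : ℝ, 0 < r ∧ K * r ^ p < c := by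
  refine ⟨(c / (K + 1)) ^ p⁻¹, by positivity, ?_⟩
  rw [← Real.rpow_mul (by positivity), inv_mul_cancel₀ hp.ne', Real.rpow_one,
    mul_div_assoc', div_lt_iff₀ (by positivity)]
  nlinarith

variable {N : ℕ} {Ω : Opens (EuclideanSpace ℝ (Fin N))} {p : ℝ}

theorem lintegral_fderiv_testFunction (hp : 1 < p) [Fact (1 ≤ ENNReal.ofReal p)] (φ : 𝓓(Ω, ℝ)) :
    ∫⁻ x, ‖fderiv ℝ φ x‖ₑ ^ p = ‖(testPair Ω p φ).2‖ₑ ^ p := by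
  have hp0 : 0 < p := by linarith
  have henorm : ∀ x, ‖fderiv ℝ φ x‖ₑ = ‖gradient φ x‖ₑ := fun x => by
    rw [← ofReal_norm, ← ofReal_norm, norm_gradient_testFunction]
  simp_rw [henorm]
  rw [show (testPair Ω p φ).2 = (memLp_gradient_testFunction φ _).toLp (gradient φ) from rfl,
    Lp.enorm_toLp, eLpNorm_ofReal_rpow hp0,
    ← setLIntegral_eq_of_support_subset (s := (Ω : Set (EuclideanSpace ℝ (Fin N))))]
  intro x hx
  by_contra hxΩ
  have hz : gradient φ x = 0 := by
    rw [gradient, fderiv_testFunction_eq_zero φ hxΩ, map_zero]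
  simp [hz, hp0] at hx

theorem setLIntegral_testFunction (hp : 1 < p) [Fact (1 ≤ ENNReal.ofReal p)] (φ : 𝓓(Ω, ℝ)) :
    ∫⁻ x in (Ω : Set (EuclideanSpace ℝ (Fin N))), ‖φ x‖ₑ ^ p = ‖(testPair Ω p φ).1‖ₑ ^ p := by
  have hp0 : 0 < p := by linarith
  rw [show (testPair Ω p φ).1 = (memLp_testFunction φ _).toLp φ from rfl,
    Lp.enorm_toLp, eLpNorm_ofReal_rpow hp0]

theorem lintegral_testFunction (hp : 1 < p) [Fact (1 ≤ ENNReal.ofReal p)] (φ : 𝓓(Ω, ℝ)) :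
    ∫⁻ x, ‖φ x‖ₑ ^ p = ‖(testPair Ω p φ).1‖ₑ ^ p := by
  have hp0 : 0 < p := by linarith
  rw [← setLIntegral_testFunction hp,
    ← setLIntegral_eq_of_support_subset (s := (Ω : Set (EuclideanSpace ℝ (Fin N))))]
  intro x hx
  by_contra hxΩ
  simp [testFunction_eq_zero φ hxΩ, hp0] at hx

/-- **Rellich–Kondrachov** for test functions: the averages over finitely many small balls covering
`Ω` range in a bounded subset of a finite-dimensional space and determine a test function in
`L^p(Ω)` up to a small error. -/
theorem totallyBounded_testFunction (hp : 1 < p) [Fact (1 ≤ ENNReal.ofReal p)]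
    (hΩ : Bornology.IsBounded (Ω : Set (EuclideanSpace ℝ (Fin N)))) {M : ℝ} (hM : 0 ≤ M) :
    TotallyBounded ((fun φ : 𝓓(Ω, ℝ) => (testPair Ω p φ).1) '' {φ | ‖testPair Ω p φ‖ ≤ M}) := by
  have hp0 : 0 < p := by linarith
  refine totallyBounded_image_of_approx fun ε hε => ?_
  -- The mean oscillation contributes at most `K₁ * r ^ p` and the averages at most `K₂ * η ^ p` to
  -- the `p`-th power of the distance of two test functions whose averages are `η`-close.
  set K₁ : ℝ := 2 ^ (p - 1) * (2 ^ N * (2 ^ p * (2 * M) ^ p)) with hK₁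
  set K₂ : ℝ := 2 ^ (p - 1) * (volume (Ω : Set (EuclideanSpace ℝ (Fin N)))).toReal with hK₂
  obtain ⟨r, hr, hrε⟩ := exists_pos_mul_rpow_lt hp0 (by positivity : 0 ≤ K₁)
    (by positivity : 0 < ε ^ p / 2)
  obtain ⟨η, hη, hηε⟩ := exists_pos_mul_rpow_lt hp0 (by positivity : 0 ≤ K₂)
    (by positivity : 0 < ε ^ p / 2)
  have htb : TotallyBounded (Ω : Set (EuclideanSpace ℝ (Fin N))) :=
    hΩ.isCompact_closure.totallyBounded.subset subset_closure
  obtain ⟨t, ht, htΩ⟩ := Metric.totallyBounded_iff.1 htb r hr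
  have := ht.fintype
  refine ⟨t → ℝ, inferInstance, fun φ z => ⨍ y in Metric.ball (z : EuclideanSpace ℝ (Fin N)) r, φ y,
    η, hη, ?_, ?_⟩
  · set L : ℝ≥0∞ := (ENNReal.ofReal M ^ p /
      volume (Metric.ball (0 : EuclideanSpace ℝ (Fin N)) r)) ^ p⁻¹ with hL
    have hLt : L ≠ ∞ := ENNReal.rpow_ne_top_of_nonneg (by positivity) (ENNReal.div_ne_top
      (ENNReal.rpow_ne_top_of_nonneg hp0.le ENNReal.ofReal_ne_top)
      (Metric.measure_ball_pos volume _ hr).ne')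
    refine (isCompact_closedBall (0 : t → ℝ) L.toReal).totallyBounded.subset ?_
    rintro _ ⟨φ, hφ, rfl⟩
    rw [mem_closedBall_zero_iff, pi_norm_le_iff_of_nonneg ENNReal.toReal_nonneg]
    intro z
    rw [← toReal_enorm]
    refine ENNReal.toReal_mono hLt ?_
    rw [hL, ENNReal.le_rpow_inv_iff hp0]
    refine (enorm_average_rpow_le hp hr φ.continuous _).trans ?_
    gcongr
    refine (setLIntegral_le_lintegral _ _).trans ?_
    rw [lintegral_testFunction hp, ← ofReal_norm]
    gcongr
    exact (norm_fst_le _).trans hφ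
  · intro φ hφ ψ hψ hd
    have hvol : volume (Ω : Set (EuclideanSpace ℝ (Fin N))) ≠ ∞ := hΩ.measure_lt_top.ne
    have hw : ‖testPair Ω p (φ - ψ)‖ ≤ 2 * M := by
      rw [map_sub]
      exact (norm_sub_le _ _).trans (by linarith [hφ.out, hψ.out])
    have hw2 : ‖(testPair Ω p (φ - ψ)).2‖ₑ ≤ ENNReal.ofReal (2 * M) := by
      rw [← ofReal_norm]
      exact ENNReal.ofReal_le_ofReal ((norm_snd_le _).trans hw)
    have hav : ∀ z ∈ t, ‖⨍ y in Metric.ball z r, (φ - ψ) y‖ₑ ≤ ENNReal.ofReal η := by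
      intro z hz
      have hint : ∀ f : 𝓓(Ω, ℝ), IntegrableOn f (Metric.ball z r) := fun f =>
        (f.continuous.integrable_of_hasCompactSupport f.hasCompactSupport).integrableOn
      have h1 : ⨍ y in Metric.ball z r, (φ - ψ) y =
          (⨍ y in Metric.ball z r, φ y) - ⨍ y in Metric.ball z r, ψ y := by
        rw [average, average, average,
          ← integral_sub (hint φ).integrable.to_average (hint ψ).integrable.to_average]
        rfl
      rw [h1, ← ofReal_norm, ← dist_eq_norm]
      exact ENNReal.ofReal_le_ofReal ((dist_le_pi_dist _ _ (⟨z, hz⟩ : t)).trans hd.le)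
    have hmain := setLIntegral_rpow_le_of_average_le hp hr (contDiff_testFunction (φ - ψ) 1)
      Ω.isOpen.measurableSet htΩ hav
    rw [setLIntegral_testFunction hp, lintegral_fderiv_testFunction hp,
      finrank_euclideanSpace_fin] at hmain
    have hlt : ‖(testPair Ω p (φ - ψ)).1‖ₑ ^ p < ENNReal.ofReal ε ^ p := by
      refine hmain.trans_lt ?_
      calc _ ≤ 2 ^ (p - 1) * (2 ^ N * ENNReal.ofReal (2 * r) ^ p * ENNReal.ofReal (2 * M) ^ p +
            ENNReal.ofReal η ^ p * volume (Ω : Set (EuclideanSpace ℝ (Fin N)))) := by gcongr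
        _ = ENNReal.ofReal (K₁ * r ^ p + K₂ * η ^ p) := by
          have h2 : (2 : ℝ≥0∞) ^ (p - 1) = ENNReal.ofReal (2 ^ (p - 1)) := by
            rw [← ENNReal.ofReal_rpow_of_pos two_pos, ENNReal.ofReal_ofNat]
          have hN : (2 : ℝ≥0∞) ^ N = ENNReal.ofReal (2 ^ N) := by
            rw [ENNReal.ofReal_pow zero_le_two, ENNReal.ofReal_ofNat]
          rw [h2, hN, ← ENNReal.ofReal_toReal hvol,
            ENNReal.ofReal_rpow_of_nonneg (by positivity) hp0.le,
            ENNReal.ofReal_rpow_of_nonneg (by positivity) hp0.le,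
            ENNReal.ofReal_rpow_of_nonneg (by positivity) hp0.le,
            ← ENNReal.ofReal_mul (by positivity), ← ENNReal.ofReal_mul (by positivity),
            ← ENNReal.ofReal_mul (by positivity), ← ENNReal.ofReal_add (by positivity)
              (by positivity), ← ENNReal.ofReal_mul (by positivity), hK₁, hK₂,
            Real.mul_rpow zero_le_two hr.le]
          congr 1
          ring
        _ < ENNReal.ofReal ε ^ p := by
          rw [ENNReal.ofReal_rpow_of_pos hε]
          exact (ENNReal.ofReal_lt_ofReal_iff (by positivity)).2 (by linarith)
    have hlt' := (ENNReal.rpow_lt_rpow_iff hp0).1 hlt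
    rw [← ofReal_norm, ENNReal.ofReal_lt_ofReal_iff hε, map_sub] at hlt'
    rwa [dist_eq_norm]

/-- **Rellich–Kondrachov**: bounded sets of `W_0^{1,p}(Ω)` are totally bounded in `L^p(Ω)`. -/
theorem totallyBounded_sobolevZero (hp : 1 < p) [Fact (1 ≤ ENNReal.ofReal p)]
    (hΩ : Bornology.IsBounded (Ω : Set (EuclideanSpace ℝ (Fin N)))) {M : ℝ} (hM : 0 ≤ M) :
    TotallyBounded (Prod.fst '' {w | w ∈ sobolevZero Ω p ∧ ‖w‖ ≤ M}) := by
  refine (totallyBounded_testFunction (Ω := Ω) hp hΩ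
    (by linarith : 0 ≤ M + 1)).closure.subset ?_
  rintro _ ⟨w, ⟨hw, hwM⟩, rfl⟩
  rw [Metric.mem_closure_iff]
  intro ε hε
  rw [sobolevZero, ← SetLike.mem_coe, Submodule.topologicalClosure_coe,
    Metric.mem_closure_iff] at hw
  obtain ⟨_, ⟨φ, rfl⟩, hφ⟩ := hw (min ε 1) (by positivity)
  refine ⟨_, ⟨φ, ?_, rfl⟩, ?_⟩
  · have h1 : dist w (testPair Ω p φ) < 1 := hφ.trans_le (min_le_right _ _)
    rw [dist_eq_norm, norm_sub_rev] at h1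
    have := norm_le_norm_add_norm_sub' (testPair Ω p φ) w
    exact this.trans (by linarith)
  · refine lt_of_le_of_lt ?_ (hφ.trans_le (min_le_left _ _))
    exact le_max_left _ _

end Rellich

/-! ### Existence of minimal partitions -/

section Existence

theorem setLIntegral_eq_of_ae_eq_zero {α : Type*} [MeasurableSpace α] {μ : Measure α}
    {s t : Set α} (hst : s ⊆ t) (hs : NullMeasurableSet s μ) {f : α → ℝ≥0∞}
    (hf : ∀ᵐ x ∂μ.restrict t, x ∉ s → f x = 0) : ∫⁻ x in s, f x ∂μ = ∫⁻ x in t, f x ∂μ := by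
  have hs' : NullMeasurableSet s (μ.restrict t) := hs.mono_ac Measure.absolutelyContinuous_restrict
  have h : ∫⁻ x in t, f x ∂μ = ∫⁻ x in t, s.indicator f x ∂μ := by
    refine lintegral_congr_ae ?_
    filter_upwards [hf] with x hx
    by_cases hxs : x ∈ s
    · rw [Set.indicator_of_mem hxs]
    · rw [Set.indicator_of_notMem hxs, hx hxs]
  rw [h, lintegral_indicator₀ hs', Measure.restrict_restrict₀ hs', Set.inter_eq_left.2 hst]

theorem ae_eq_zero_or_of_tendsto_Lp {α : Type*} [MeasurableSpace α] {μ : Measure α} {q : ℝ≥0∞}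
    [Fact (1 ≤ q)] {f g : ℕ → Lp ℝ q μ} {f₀ g₀ : Lp ℝ q μ} (hf : Tendsto f atTop (𝓝 f₀))
    (hg : Tendsto g atTop (𝓝 g₀)) (hfg : ∀ n, ∀ᵐ x ∂μ, f n x = 0 ∨ g n x = 0) :
    ∀ᵐ x ∂μ, f₀ x = 0 ∨ g₀ x = 0 := by
  obtain ⟨a, ha, hfa⟩ := (tendstoInMeasure_of_tendsto_Lp hf).exists_seq_tendsto_ae
  obtain ⟨b, hb, hgb⟩ :=
    (tendstoInMeasure_of_tendsto_Lp (hg.comp ha.tendsto_atTop)).exists_seq_tendsto_ae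
  filter_upwards [hfa, hgb, ae_all_iff.2 hfg] with x hx hy hxy
  have h := (hx.comp hb.tendsto_atTop).mul hy
  have h0 : ∀ n, f (a (b n)) x * g (a (b n)) x = 0 := fun n => mul_eq_zero.2 (hxy _)
  exact mul_eq_zero.1 (tendsto_nhds_unique h (tendsto_const_nhds.congr fun n => (h0 n).symm))

variable {N : ℕ} {Ω : Opens (EuclideanSpace ℝ (Fin N))} {p : ℝ}

/-- An admissible function with small Rayleigh quotient, normalised in `L^p(Ω)`. Stampacchia's lemma
turns the integral of `|∇u|^p` over `E` into the integral over `Ω`. -/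
theorem exists_normalized_of_rayleighQuotient_le (hp : 1 < p) [Fact (1 ≤ ENNReal.ofReal p)]
    [IsFiniteMeasure (volume.restrict (Ω : Set (EuclideanSpace ℝ (Fin N))))]
    {E : Set (EuclideanSpace ℝ (Fin N))} (hE : NullMeasurableSet E volume)
    (hEΩ : E ⊆ Ω) {u : EuclideanSpace ℝ (Fin N) → ℝ}
    {G : EuclideanSpace ℝ (Fin N) → EuclideanSpace ℝ (Fin N)} (h : IsAdmissible Ω p E u G)
    {c : ℝ≥0∞} (hc : c ≠ ∞) (huc : rayleighQuotient p E u G ≤ c) :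
    ∃ w ∈ sobolevZero Ω p, ‖w.1‖ = 1 ∧ ‖w.2‖ ≤ c.toReal ^ p⁻¹ ∧
      ∀ᵐ x ∂volume.restrict (Ω : Set (EuclideanSpace ℝ (Fin N))), x ∉ E → w.1 x = 0 := by
  have hp0 : 0 < p := by linarith
  set a := h.memW01p.memLp.toLp u with ha
  set b := h.memW01p.memLp_grad.toLp G with hb
  have hu0 : ∀ᵐ x ∂volume.restrict (Ω : Set (EuclideanSpace ℝ (Fin N))), x ∉ E → u x = 0 := by
    rw [ae_restrict_iff' Ω.isOpen.measurableSet]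
    filter_upwards [h.eq_zero] with x hx hxΩ hxE using hx ⟨hxΩ, hxE⟩
  have hua : ∫⁻ x in E, ‖u x‖ₑ ^ p = ‖a‖ₑ ^ p := by
    rw [ha, Lp.enorm_toLp, eLpNorm_ofReal_rpow hp0]
    refine setLIntegral_eq_of_ae_eq_zero hEΩ hE ?_
    filter_upwards [hu0] with x hx hxE
    simp [hx hxE, hp0]
  have hGb : ∫⁻ x in E, ‖G x‖ₑ ^ p = ‖b‖ₑ ^ p := by
    rw [hb, Lp.enorm_toLp, eLpNorm_ofReal_rpow hp0]
    refine setLIntegral_eq_of_ae_eq_zero hEΩ hE ?_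
    filter_upwards [hu0, h.memW01p.ae_grad_eq_zero hp] with x hx hG hxE
    simp [hG (hx hxE), hp0]
  have ha0 : 0 < ‖a‖ := by
    refine norm_pos_iff.2 fun h0 => h.ne_zero ?_
    exact (MemLp.coeFn_toLp h.memW01p.memLp).symm.trans
      ((Lp.ext_iff.1 h0).trans (Lp.coeFn_zero _ _ _))
  have hba : ‖b‖ ≤ c.toReal ^ p⁻¹ * ‖a‖ := by
    rw [rayleighQuotient, hua, hGb, ENNReal.div_le_iff
      (by simp [hp0, enorm_eq_zero, norm_pos_iff.1 ha0])
      (ENNReal.rpow_ne_top_of_nonneg hp0.le enorm_ne_top)] at huc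
    have h1 : ‖b‖ ^ p ≤ c.toReal * ‖a‖ ^ p := by
      have := ENNReal.toReal_mono (ENNReal.mul_ne_top hc
        (ENNReal.rpow_ne_top_of_nonneg hp0.le enorm_ne_top)) huc
      rwa [ENNReal.toReal_mul, ← ENNReal.toReal_rpow, ← ENNReal.toReal_rpow, toReal_enorm,
        toReal_enorm] at this
    refine (Real.rpow_le_rpow_iff (norm_nonneg _) (by positivity) hp0).1 ?_
    rwa [Real.mul_rpow (by positivity) (norm_nonneg _), ← Real.rpow_mul ENNReal.toReal_nonneg,
      inv_mul_cancel₀ hp0.ne', Real.rpow_one]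
  refine ⟨‖a‖⁻¹ • (a, b), Submodule.smul_mem _ _ h.memW01p.toLp_mem_sobolevZero, ?_, ?_, ?_⟩
  · rw [Prod.smul_fst, norm_smul, norm_inv, norm_norm, inv_mul_cancel₀ ha0.ne']
  · rw [Prod.smul_snd, norm_smul, norm_inv, norm_norm, inv_mul_le_iff₀ ha0, mul_comm]
    exact hba
  · filter_upwards [Lp.coeFn_smul ‖a‖⁻¹ a, MemLp.coeFn_toLp h.memW01p.memLp, hu0]
      with x h1 h2 h3 hxE
    rw [Prod.smul_fst, h1, Pi.smul_apply, ha, h2, h3 hxE, smul_zero]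

/-- A nonempty open set contains `k` disjoint nonempty open sets. -/
theorem partitions_nonempty (hN : 0 < N) (hne : (Ω : Set (EuclideanSpace ℝ (Fin N))).Nonempty)
    (k : ℕ) : (partitions Ω k).Nonempty := by
  have : Nonempty (Fin N) := ⟨⟨0, hN⟩⟩
  obtain ⟨x₀, hx₀⟩ := hne
  have := Module.punctured_nhds_neBot ℝ (EuclideanSpace ℝ (Fin N)) x₀
  have hinf : (Ω : Set (EuclideanSpace ℝ (Fin N))).Infinite :=
    infinite_of_mem_nhds x₀ (Ω.isOpen.mem_nhds hx₀)
  let y : Fin k → EuclideanSpace ℝ (Fin N) := fun i => hinf.natEmbedding _ i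
  have hy : Function.Injective y :=
    Subtype.val_injective.comp ((hinf.natEmbedding _).injective.comp Fin.val_injective)
  obtain ⟨U, hU, hdisj⟩ := (Set.finite_range y).t2_separation
  refine ⟨fun i => U (y i) ∩ Ω, fun i => ?_, fun i => Set.inter_subset_right, fun i => ?_,
    fun i j hij => ?_⟩
  · exact ((hU _).2.inter Ω.isOpen).measurableSet.nullMeasurableSet
  · exact ((hU _).2.inter Ω.isOpen).measure_pos volume
      ⟨y i, (hU _).1, (hinf.natEmbedding _ (i : ℕ)).2⟩
  · exact (hdisj ⟨i, rfl⟩ ⟨j, rfl⟩ (hy.ne hij)).mono Set.inter_subset_left Set.inter_subset_left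

/-- Normalised functions of `W_0^{1,p}(Ω)` with almost everywhere disjoint supports yield a
`k`-tuple of disjoint sets whose energy is bounded by the gradient norms. -/
theorem exists_partition_of_disjoint_supports (hp : 1 < p) [Fact (1 ≤ ENNReal.ofReal p)]
    [IsFiniteMeasure (volume.restrict (Ω : Set (EuclideanSpace ℝ (Fin N))))] {k : ℕ}
    {w : Fin k →
      Lp ℝ (ENNReal.ofReal p) (volume.restrict (Ω : Set (EuclideanSpace ℝ (Fin N)))) ×
      Lp (EuclideanSpace ℝ (Fin N)) (ENNReal.ofReal p)
        (volume.restrict (Ω : Set (EuclideanSpace ℝ (Fin N))))}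
    (hw : ∀ i, w i ∈ sobolevZero Ω p) (hw1 : ∀ i, ‖(w i).1‖ = 1) {m : ℝ≥0∞} (hm : m ≠ ∞)
    (hw2 : ∀ i, ‖(w i).2‖ ≤ m.toReal ^ p⁻¹)
    (hdisj : ∀ i j, i ≠ j → ∀ᵐ x ∂volume.restrict (Ω : Set (EuclideanSpace ℝ (Fin N))),
      (w i).1 x = 0 ∨ (w j).1 x = 0) :
    ∃ E ∈ partitions Ω k, partitionEnergy Ω p E ≤ m := by
  have hp0 : 0 < p := by linarith
  -- Removing the points where another function is nonzero makes the supports disjoint.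
  let E : Fin k → Set (EuclideanSpace ℝ (Fin N)) := fun i =>
    (Ω : Set (EuclideanSpace ℝ (Fin N))) ∩
      ({x | (w i).1 x ≠ 0} ∩ ⋂ j, ⋂ _ : i ≠ j, {x | (w j).1 x = 0})
  have hz : ∀ j, MeasurableSet {x | (w j).1 x = 0} := fun j =>
    (Lp.stronglyMeasurable (w j).1).measurable (measurableSet_singleton 0)
  have hEm : ∀ i, MeasurableSet (E i) := fun i =>
    Ω.isOpen.measurableSet.inter ((hz i).compl.inter
      (MeasurableSet.iInter fun j => MeasurableSet.iInter fun _ => hz j))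
  have hEΩ : ∀ i, E i ⊆ Ω := fun i => Set.inter_subset_left
  have hE0 : ∀ i, ∀ᵐ x ∂volume.restrict (Ω : Set (EuclideanSpace ℝ (Fin N))),
      x ∉ E i → (w i).1 x = 0 := by
    intro i
    have hall : ∀ᵐ x ∂volume.restrict (Ω : Set (EuclideanSpace ℝ (Fin N))), ∀ j, i ≠ j →
        (w i).1 x = 0 ∨ (w j).1 x = 0 := by
      refine ae_all_iff.2 fun j => ?_
      by_cases hij : i = j
      · exact Eventually.of_forall fun x h => absurd hij h
      · filter_upwards [hdisj i j hij] with x hx _ using hx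
    filter_upwards [hall, ae_restrict_mem Ω.isOpen.measurableSet] with x hx hxΩ hxE
    by_contra hne
    exact hxE ⟨hxΩ, hne, Set.mem_iInter₂.2 fun j hij => (hx j hij).resolve_left hne⟩
  have hone : ∀ i, ∫⁻ x in E i, ‖(w i).1 x‖ₑ ^ p = 1 := by
    intro i
    rw [setLIntegral_eq_of_ae_eq_zero (hEΩ i) (hEm i).nullMeasurableSet, ← eLpNorm_ofReal_rpow hp0,
      ← Lp.enorm_def, ← ofReal_norm, hw1 i]
    · simp
    · filter_upwards [hE0 i] with x hx hxE
      simp [hx hxE, hp0]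
  refine ⟨E, ⟨fun i => (hEm i).nullMeasurableSet, hEΩ, fun i => ?_, fun i j hij => ?_⟩, ?_⟩
  · rw [pos_iff_ne_zero]
    intro h0
    have := hone i
    rw [Measure.restrict_eq_zero.2 h0, lintegral_zero_measure] at this
    exact zero_ne_one this
  · refine Set.disjoint_left.2 fun x hxi hxj => hxi.2.1 ?_
    exact Set.mem_iInter₂.1 hxj.2.2 i hij.symm
  · refine iSup_le fun i => ?_
    have hadm : IsAdmissible Ω p (E i) (w i).1 (w i).2 := by
      refine ⟨memW01p_of_toLp_mem hp (Lp.memLp _) (Lp.memLp _) ?_, fun h0 => ?_, ?_⟩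
      · rw [Lp.toLp_coeFn, Lp.toLp_coeFn]
        exact hw i
      · have h1 : (w i).1 = 0 := Lp.ext (h0.trans (Lp.coeFn_zero _ _ _).symm)
        have h2 := hw1 i
        rw [h1, norm_zero] at h2
        exact zero_ne_one h2
      · have := hE0 i
        rw [ae_restrict_iff' Ω.isOpen.measurableSet] at this
        filter_upwards [this] with x hx hxd using hx hxd.1 hxd.2
    refine iInf_le_of_le (w i).1 (iInf_le_of_le (w i).2 (iInf_le_of_le hadm ?_))
    rw [rayleighQuotient, hone i, div_one]
    refine (lintegral_mono_set (hEΩ i)).trans ?_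
    rw [← eLpNorm_ofReal_rpow hp0, ← Lp.enorm_def, ← ENNReal.le_rpow_inv_iff hp0, ← ofReal_norm]
    refine (ENNReal.ofReal_le_ofReal (hw2 i)).trans ?_
    rw [← ENNReal.ofReal_rpow_of_nonneg ENNReal.toReal_nonneg (by positivity),
      ENNReal.ofReal_toReal hm]

/-- The direct method: normalised almost optimal competitors converge in `L^p(Ω)`, along a
subsequence, to functions with disjoint supports whose gradients obey the bound given by the
infimum. -/
theorem exists_partition_le_minimalPartitionValue (hp : 1 < p)
    (hbdd : Bornology.IsBounded (Ω : Set (EuclideanSpace ℝ (Fin N)))) (k : ℕ)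
    (hfin : minimalPartitionValue Ω p k ≠ ∞) :
    ∃ E ∈ partitions Ω k, partitionEnergy Ω p E ≤ minimalPartitionValue Ω p k := by
  have hp0 : 0 < p := by linarith
  have : Fact (1 ≤ ENNReal.ofReal p) := ⟨by simpa using hp.le⟩
  have : IsFiniteMeasure (volume.restrict (Ω : Set (EuclideanSpace ℝ (Fin N)))) :=
    ⟨by simpa using hbdd.measure_lt_top⟩
  have := uniformConvexSpace_Lp (F := EuclideanSpace ℝ (Fin N))
    (μ := volume.restrict (Ω : Set (EuclideanSpace ℝ (Fin N)))) hp
  set m := minimalPartitionValue Ω p k with hm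
  set c : ℕ → ℝ≥0∞ := fun n => m + ENNReal.ofReal (1 / ((n : ℝ) + 1)) with hc
  have hct : ∀ n, c n ≠ ∞ := fun n => ENNReal.add_ne_top.2 ⟨hfin, ENNReal.ofReal_ne_top⟩
  have hctoReal : ∀ n, (c n).toReal = m.toReal + 1 / ((n : ℝ) + 1) := fun n => by
    rw [ENNReal.toReal_add hfin ENNReal.ofReal_ne_top, ENNReal.toReal_ofReal (by positivity)]
  have hmc : ∀ n, m < c n := fun n =>
    ENNReal.lt_add_right hfin (by simp; positivity)
  have hex : ∀ n, ∃ w : Fin k →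
      Lp ℝ (ENNReal.ofReal p) (volume.restrict (Ω : Set (EuclideanSpace ℝ (Fin N)))) ×
      Lp (EuclideanSpace ℝ (Fin N)) (ENNReal.ofReal p)
        (volume.restrict (Ω : Set (EuclideanSpace ℝ (Fin N)))),
      (∀ i, w i ∈ sobolevZero Ω p) ∧ (∀ i, ‖(w i).1‖ = 1) ∧
      (∀ i, ‖(w i).2‖ ≤ (c n).toReal ^ p⁻¹) ∧
      ∀ i j, i ≠ j → ∀ᵐ x ∂volume.restrict (Ω : Set (EuclideanSpace ℝ (Fin N))),
        (w i).1 x = 0 ∨ (w j).1 x = 0 := by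
    intro n
    have h1 := hmc n
    rw [hm, minimalPartitionValue] at h1
    obtain ⟨E, h2⟩ := iInf_lt_iff.1 h1
    obtain ⟨hE, hlt⟩ := iInf_lt_iff.1 h2
    have hi : ∀ i, ∃ w ∈ sobolevZero Ω p, ‖w.1‖ = 1 ∧ ‖w.2‖ ≤ (c n).toReal ^ p⁻¹ ∧
        ∀ᵐ x ∂volume.restrict (Ω : Set (EuclideanSpace ℝ (Fin N))), x ∉ E i → w.1 x = 0 := by
      intro i
      have h3 : firstEigenvalue Ω p (E i) < c n :=
        (le_iSup (fun i => firstEigenvalue Ω p (E i)) i).trans_lt hlt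
      obtain ⟨u, h4⟩ := iInf_lt_iff.1 h3
      obtain ⟨G, h5⟩ := iInf_lt_iff.1 h4
      obtain ⟨hadm, h6⟩ := iInf_lt_iff.1 h5
      exact exists_normalized_of_rayleighQuotient_le hp (hE.1 i) (hE.2.1 i) hadm (hct n) h6.le
    choose w hw hw1 hw2 hw0 using hi
    refine ⟨w, hw, hw1, hw2, fun i j hij => ?_⟩
    filter_upwards [hw0 i, hw0 j] with x hxi hxj
    by_cases hx : x ∈ E i
    · exact Or.inr (hxj (Set.disjoint_left.1 (hE.2.2.2 hij) hx))
    · exact Or.inl (hxi hx)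
  choose w hw hw1 hw2 hwd using hex
  -- The norm on the product `L^p × L^p` is the maximum of the two norms.
  set M : ℝ := max 1 ((m.toReal + 1) ^ p⁻¹) with hM
  have hwM : ∀ n i, ‖w n i‖ ≤ M := by
    intro n i
    refine max_le_max (hw1 n i).le ((hw2 n i).trans ?_)
    rw [hctoReal]
    have : 1 / ((n : ℝ) + 1) ≤ 1 := by
      rw [div_le_one (by positivity)]
      linarith [(Nat.cast_nonneg n : (0 : ℝ) ≤ n)]
    gcongr
  have hcpt := isCompact_univ_pi fun _ : Fin k =>
    (totallyBounded_sobolevZero (Ω := Ω) (p := p) hp hbdd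
      (le_max_of_le_left zero_le_one : 0 ≤ M)).closure.isCompact_of_isClosed isClosed_closure
  obtain ⟨v, -, s, hs, hv⟩ := hcpt.tendsto_subseq (x := fun n i => (w n i).1)
    fun n i _ => subset_closure ⟨w n i, ⟨hw n i, hwM n i⟩, rfl⟩
  have hvi : ∀ i, Tendsto (fun n => (w (s n) i).1) atTop (𝓝 (v i)) := tendsto_pi_nhds.1 hv
  have hr : Tendsto (fun n => (c (s n)).toReal ^ p⁻¹) atTop (𝓝 (m.toReal ^ p⁻¹)) := by
    refine Tendsto.rpow_const ?_ (Or.inr (by positivity))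
    simp_rw [hctoReal]
    have h0 := ((tendsto_one_div_add_atTop_nhds_zero_nat (𝕜 := ℝ)).comp hs.tendsto_atTop).const_add
      m.toReal
    simpa [Function.comp_def] using h0
  have hlim : ∀ i, ∃ g, (v i, g) ∈ sobolevZero Ω p ∧ ‖g‖ ≤ m.toReal ^ p⁻¹ := fun i =>
    exists_mem_of_tendsto_fst (K := (sobolevZero Ω p : Set _))
      (Submodule.isClosed_topologicalClosure _) (sobolevZero Ω p).convex
      (fun n => hw (s n) i) (hvi i) (fun n => hw2 (s n) i) hr
  choose g hg hgm using hlim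
  refine exists_partition_of_disjoint_supports (w := fun i => (v i, g i)) hp hg (fun i => ?_) hfin
    hgm fun i j hij => ?_
  · refine tendsto_nhds_unique (hvi i).norm ?_
    simp [hw1]
  · exact ae_eq_zero_or_of_tendsto_Lp (hvi i) (hvi j) fun n => hwd (s n) i j hij

end Existence

end SpectralPartition

theorem mainTheorem8 {N : ℕ} (hN : 2 ≤ N) (Ω : Opens (EuclideanSpace ℝ (Fin N)))
    (hbdd : Bornology.IsBounded (Ω : Set (EuclideanSpace ℝ (Fin N))))
    (hne : (Ω : Set (EuclideanSpace ℝ (Fin N))).Nonempty)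
    (k : ℕ) (hk : 1 ≤ k) (p : ℝ) (hp : 1 < p) :
    ∃ E : Fin k → Set (EuclideanSpace ℝ (Fin N)),
      SpectralPartition.IsSpectralMinimalPartition Ω p E := by
  have hle : ∀ E ∈ SpectralPartition.partitions Ω k,
      SpectralPartition.minimalPartitionValue Ω p k ≤ SpectralPartition.partitionEnergy Ω p E :=
    fun E hE => iInf₂_le E hE
  -- An infinite infimum is attained at every tuple, so that only the existence of a tuple is
  -- needed.
  by_cases hfin : SpectralPartition.minimalPartitionValue Ω p k = ∞
  · obtain ⟨E, hE⟩ := SpectralPartition.partitions_nonempty (by omega) hne k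
    exact ⟨E, hE, le_antisymm (hfin ▸ le_top) (hle E hE)⟩
  · obtain ⟨E, hE, hEm⟩ :=
      SpectralPartition.exists_partition_le_minimalPartitionValue hp hbdd k hfin
    exact ⟨E, hE, le_antisymm hEm (hle E hE)⟩
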